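/- **Setting.** Graphs are finite, simple and undirected, with node set $\{1,\dots,N\}$; $S\in\{0,1\}^{N\times N}$ is the adjacency matrix. Fix an integer $p\ge 2$. A *GNN with power nonlinearity $x\mapsto x^p$* is a composition of finitely many (at least one) layers $$X^{(l)}=\sigma_l\Big(\sum_{k=0}^{1} S^k X^{(l-1)} H^{(l)}_k\Big),$$ where $X^{(l)}\in\mathbb R^{N\times F_l}$, the $H^{(l)}_k$ are real matrices, and $\sigma_l$ acts on each row (node) separately as a multi-layer perceptron with one hidden layer and activation $x\mapsto x^p$, that is, $\sigma_l(z)=(zW_1+b_1)^{p}\,W_2+b_2$ with the power taken entrywise. The parameters (number of layers, widths, matrices $H^{(l)}_k,W_1,W_2$, vectors $b_1,b_2$) do not depend on the graph or on $N$. For a node signal $x\in\mathbb R^N$, used as input $X^{(0)}=x$ (so $F_0=1$), the output is $\Phi(\mathcal G,x)\in\mathbb R^{N\times F_L}$, where $L$ is the number of layers. For a node $v$ let $c_k(\mathcal G,v)$ be the number of cycles with $k$ nodes that contain $v$, i.e. of (not necessarily induced) subgraphs of $\mathcal G$ that contain $v$ and are isomorphic to the $k$-cycle. **Statement (Structure Counting).**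 Let $p\ge2$ be an integer. 1. Let $\mu$ be a probability distribution on $\mathbb R$ with all moments finite, mean $0$ and variance $1$. There is a GNN $\Phi$ with nonlinearity $x\mapsto x^p$ and output dimension $5$ such that for every $N$, every graph $\mathcal G$ on $N$ nodes, and all i.i.d. random variables $q=(q_1,\dots,q_N)$ with distribution $\mu$, the output $\Phi(\mathcal G,q)$ is integrable and $$\mathbb E\big[\Phi(\mathcal G,q)\big]_{v,\cdot}=\big(c_3(\mathcal G,v),c_4(\mathcal G,v),c_5(\mathcal G,v),c_6(\mathcal G,v),c_7(\mathcal G,v)\big)\qquad\text{for every node }v.$$ 2. There is a GNN $\Psi$ with nonlinearity $x\mapsto x^p$ and output dimension $5$ such that for every $N$ and every graph $\mathcal G$ on $N$ nodes, with $e_1,\dots,e_N$ the standard basis vectors of $\mathbb R^N$, $$\sum_{m=1}^N\Psi(\mathcal G,e_m)_{v,\cdot}=\big(c_3(\mathcal G,v),c_4(\mathcal G,v),c_5(\mathcal G,v),c_6(\mathcal G,v),c_7(\mathcal G,v)\big)\qquad\text{for every node }v.$$ -/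

import Mathlib

open MeasureTheory ProbabilityTheory

noncomputable section

/-- A perceptron with one hidden layer of width `h`, input dimension `m` and output dimension `n`,
acting on the feature vector of a single node. Its activation function is `x ↦ x ^ p`. -/
structure PowerMLP (p m n : ℕ) where
  h : ℕ
  W₁ : Matrix (Fin m) (Fin h) ℝ
  b₁ : Fin h → ℝ
  W₂ : Matrix (Fin h) (Fin n) ℝ
  b₂ : Fin n → ℝ

/-- `z ↦ (z W₁ + b₁)^p W₂ + b₂`, where the power is taken entry by entry. -/
def PowerMLP.apply {p m n : ℕ} (σ : PowerMLP p m n) (z : Fin m → ℝ) : Fin n → ℝ :=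
  fun j => ∑ a, (∑ i, z i * σ.W₁ i a + σ.b₁ a) ^ p * σ.W₂ a j + σ.b₂ j

/-- The parameters of one message-passing layer with `K = 2` filter taps. -/
structure GNNLayer (p m n : ℕ) where
  d : ℕ
  H : Fin 2 → Matrix (Fin m) (Fin d) ℝ
  σ : PowerMLP p d n

/-- `X ↦ σ (∑_{k < 2} S^k X H_k)`, where `σ` acts on each row (that is, on each node) separately. -/
def GNNLayer.apply {p m n : ℕ} (L : GNNLayer p m n) {V : Type*} [Fintype V] [DecidableEq V]
    (S : Matrix V V ℝ) (X : Matrix V (Fin m) ℝ) : Matrix V (Fin n) ℝ :=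
  Matrix.of fun v => L.σ.apply ((∑ k : Fin 2, S ^ (k : ℕ) * X * L.H k) v)

/-- The parameters of a graph neural network: one or more layers of matching dimensions. They do
not refer to any graph. -/
inductive GNN (p m : ℕ) : ℕ → Type
  | single {n : ℕ} (L : GNNLayer p m n) : GNN p m n
  | snoc {d n : ℕ} (Φ : GNN p m d) (L : GNNLayer p d n) : GNN p m n

/-- The output of the network on the graph with shift operator `S` and node features `X`. -/
def GNN.apply {p m : ℕ} {V : Type*} [Fintype V] [DecidableEq V] (S : Matrix V V ℝ)
    (X : Matrix V (Fin m) ℝ) : {n : ℕ} → GNN p m n → Matrix V (Fin n) ℝ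
  | _, .single L => L.apply S X
  | _, .snoc Φ L => L.apply S (GNN.apply S X Φ)

/-- `Φ(G, x)`: the network run on the graph `G` with its adjacency matrix as shift operator and
with the scalar node signal `x`. -/
def GNN.run {p n : ℕ} (Φ : GNN p 1 n) {V : Type*} [Fintype V] [DecidableEq V]
    (G : SimpleGraph V) [DecidableRel G.Adj] (x : V → ℝ) : Matrix V (Fin n) ℝ :=
  Φ.apply (G.adjMatrix ℝ) (Matrix.of fun v _ => x v)

/-- The number of cycles with `k` nodes in `G` that pass through `v`: the number of subgraphs of
`G`, not necessarily induced, that contain `v` and are isomorphic to the `k`-cycle. -/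
def cycleCount {V : Type*} (G : SimpleGraph V) (k : ℕ) (v : V) : ℕ :=
  {C : G.Subgraph | v ∈ C.verts ∧ Nonempty (C.coe ≃g SimpleGraph.cycleGraph k)}.ncard

end

/-!
Twice the number of `k`-cycles through `v` is the number of injective closed walks with `k` steps
from `v`. Möbius inversion over the partitions of the `k` positions expresses it through the numbers
of closed walks that are constant on the classes of a partition, that is, through the homomorphisms
of the quotients of the `k`-cycle that send the class of the first position to `v`.

Write a quotient as a spanning tree and extra edges. The tree is summed out leaf by leaf by message
passing, and each extra edge has to come from the linear functional that is applied to the features: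
* Summation over the basis vectors `e_m` produces any set of extra edges that share an end: the
  polynomial `X_m ∏ U_{s_i}` yields `∏ S_{s_i m}`, where `U = S X`.
* The expectation produces one edge, as `E[X_a U_b] = S_{ab}`. It produces the edges `ab` and `cd`
  if `ac` and `bc` belong to the tree: `E[X_a X_c U_b U_d] = S_{ab} S_{cd} + S_{ad} S_{cb}`, where
  `S_{cb} = 1`. For the book `K_{1,1,3}`, which has three extra edges, it produces the number of
  pairs of pages at once, by a polynomial corrected with the third and fourth moments.

For `k ≤ 7` every quotient without loops has a spanning tree whose extra edges are of this kind,
which is a finite check. Power perceptrons can add and multiply features, because for `p ≥ 2` the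
span of the `p`-th powers of affine forms contains all polynomials of degree at most `2`.
-/

noncomputable section

open Polynomial in
theorem exists_forall_pow_eq_sum_mul_add_one_pow {K : Type*} [Field K] [CharZero K] {p k : ℕ}
    (hk : k ≤ p) : ∃ c : ℕ → K, ∀ t : K,
      t ^ k = ∑ b ∈ Finset.range (p + 1), c b * (t * b + 1) ^ p := by
  let node (b : ℕ) : K := b
  have hnode : Set.InjOn node (Finset.range (p + 1)) := Nat.cast_injective.injOn
  have hchoose : (p.choose k : K) ≠ 0 := by exact_mod_cast (Nat.choose_pos hk).ne'
  refine ⟨fun b => (Lagrange.basis (Finset.range (p + 1)) node b).coeff k / p.choose k,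
    fun t => ?_⟩
  -- Both sides are, up to the binomial coefficient, the `k`-th coefficient of `(t X + 1) ^ p`.
  have hdegree : ((C t * X + 1 : K[X]) ^ p).degree < (Finset.range (p + 1)).card := by
    rw [Finset.card_range, degree_lt_iff_coeff_zero]
    intro m hm
    refine coeff_eq_zero_of_natDegree_lt (lt_of_le_of_lt ?_ hm)
    compute_degree
  have hcoeff : ((C t * X + 1 : K[X]) ^ p).coeff k = t ^ k * p.choose k := by
    rw [show (C t * X + 1 : K[X]) ^ p = ((X + 1) ^ p).comp (C t * X) by simp,
      comp_C_mul_X_coeff, coeff_X_add_one_pow, mul_comm]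
  rw [Lagrange.eq_interpolate hnode hdegree, Lagrange.interpolate_apply, finsetSum_coeff] at hcoeff
  rw [← mul_div_cancel_right₀ (t ^ k) hchoose, ← hcoeff, Finset.sum_div]
  refine Finset.sum_congr rfl fun b _ => ?_
  simp only [coeff_C_mul, eval_pow, eval_add, eval_mul, eval_C, eval_X, eval_one, node]
  ring

/-- The functions of `z : ℝ^d` spanned by the `p`-th powers of affine forms, that is, the scalar
functions computed by perceptrons with activation `x ↦ x ^ p` of arbitrary width. -/
def powerSpan (p d : ℕ) : Submodule ℝ ((Fin d → ℝ) → ℝ) :=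
  Submodule.span ℝ (Set.range fun w : (Fin d → ℝ) × ℝ => fun z => (∑ i, z i * w.1 i + w.2) ^ p)

theorem affine_pow_mem_powerSpan {p d k : ℕ} (hk : k ≤ p) (w : Fin d → ℝ) (b : ℝ) :
    (fun z => (∑ i, z i * w i + b) ^ k) ∈ powerSpan p d := by
  obtain ⟨c, hc⟩ := exists_forall_pow_eq_sum_mul_add_one_pow (K := ℝ) hk
  have heq : (fun z : Fin d → ℝ => (∑ i, z i * w i + b) ^ k) = ∑ a ∈ Finset.range (p + 1),
      c a • fun z : Fin d → ℝ => (∑ i, z i * (w i * a) + (b * a + 1)) ^ p := by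
    funext z
    simp only [hc, Finset.sum_apply, Pi.smul_apply, smul_eq_mul, add_mul, Finset.sum_mul, mul_assoc,
      add_assoc]
  rw [heq]
  exact Submodule.sum_mem _ fun a _ =>
    Submodule.smul_mem _ _ (Submodule.subset_span ⟨(fun i => w i * a, b * a + 1), rfl⟩)

theorem one_mem_powerSpan (p d : ℕ) : (fun _ => 1) ∈ powerSpan p d := by
  simpa using affine_pow_mem_powerSpan (p := p) (d := d) (Nat.zero_le p) 0 0

theorem apply_mem_powerSpan {p d : ℕ} (hp : 1 ≤ p) (i : Fin d) :
    (fun z => z i) ∈ powerSpan p d := by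
  simpa [Pi.single_apply] using affine_pow_mem_powerSpan hp (Pi.single i 1) 0

theorem apply_mul_apply_mem_powerSpan {p d : ℕ} (hp : 2 ≤ p) (i j : Fin d) :
    (fun z => z i * z j) ∈ powerSpan p d := by
  have hsq (w : Fin d → ℝ) := affine_pow_mem_powerSpan hp w 0
  have polarization := Submodule.smul_mem _ (1 / 2 : ℝ) (sub_mem (sub_mem
    (hsq (Pi.single i 1 + Pi.single j 1)) (hsq (Pi.single i 1))) (hsq (Pi.single j 1)))
  convert polarization using 1
  funext z
  simp only [Pi.smul_apply, Pi.sub_apply, Pi.add_apply, Pi.single_apply, mul_add,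
    Finset.sum_add_distrib, mul_ite, mul_one, mul_zero, Finset.sum_ite_eq', Finset.mem_univ,
    if_true, smul_eq_mul]
  ring

theorem exists_powerMLP_of_mem_powerSpan {p d n : ℕ} (f : Fin n → (Fin d → ℝ) → ℝ)
    (hf : ∀ j, f j ∈ powerSpan p d) : ∃ σ : PowerMLP p d n, ∀ z j, σ.apply z j = f j z := by
  choose c hc using fun j => Finsupp.mem_span_range_iff_exists_finsupp.mp (hf j)
  let s := Finset.univ.biUnion fun j => (c j).support
  have hs (j) : (c j).support ⊆ s :=
    Finset.subset_biUnion_of_mem (fun j => (c j).support) (Finset.mem_univ j)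
  obtain ⟨h, ⟨e⟩⟩ : ∃ h, Nonempty (Fin h ≃ s) := ⟨s.card, ⟨s.equivFin.symm⟩⟩
  refine ⟨⟨h, Matrix.of fun i a => (e a).1.1 i, fun a => (e a).1.2,
    Matrix.of fun a j => c j (e a), 0⟩, fun z j => ?_⟩
  rw [← hc j, Finsupp.sum_of_support_subset _ (hs j) _ (by simp),
    Finset.sum_apply, ← Finset.sum_coe_sort, ← e.sum_comp]
  simp only [PowerMLP.apply, Matrix.of_apply, Pi.zero_apply, add_zero, Pi.smul_apply, smul_eq_mul,
    mul_comm]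

theorem exists_gnnLayer_of_mem_powerSpan.{u} {p m n : ℕ} (f : Fin n → (Fin (m + m) → ℝ) → ℝ)
    (hf : ∀ j, f j ∈ powerSpan p (m + m)) :
    ∃ L : GNNLayer p m n, ∀ {V : Type u} [Fintype V] [DecidableEq V] (S : Matrix V V ℝ)
      (X : Matrix V (Fin m) ℝ) (v : V) (j : Fin n),
      L.apply S X v j = f j (Fin.append (X v) fun i => ∑ w, S v w * X w i) := by
  obtain ⟨σ, hσ⟩ := exists_powerMLP_of_mem_powerSpan f hf
  let keep : Matrix (Fin m) (Fin (m + m)) ℝ := Matrix.of fun i => Fin.append (Pi.single i 1) 0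
  let shift : Matrix (Fin m) (Fin (m + m)) ℝ := Matrix.of fun i => Fin.append 0 (Pi.single i 1)
  refine ⟨⟨m + m, ![keep, shift], σ⟩, fun S X v j => ?_⟩
  simp only [GNNLayer.apply, Matrix.of_apply, hσ]
  congr 1
  funext a
  refine Fin.addCases (fun a => ?_) (fun a => ?_) a <;>
    simp [Fin.sum_univ_two, Matrix.mul_apply, Pi.single_apply, keep, shift, -Fin.natAdd_eq_addNat]

open MvPolynomial
open scoped Finset

universe u

/-- A finite graph, bundled with its node set, so that a graph-independent node feature is a
dependent function on `FinGraph`. -/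
structure FinGraph : Type (u + 1) where
  V : Type u
  graph : SimpleGraph V
  [fintype : Fintype V]
  [decidableEq : DecidableEq V]
  [decidableAdj : DecidableRel graph.Adj]

attribute [instance] FinGraph.fintype FinGraph.decidableEq FinGraph.decidableAdj

/-- The adjacency matrix of `𝒢`. -/
def FinGraph.S (𝒢 : FinGraph.{u}) : Matrix 𝒢.V 𝒢.V ℝ := 𝒢.graph.adjMatrix ℝ

/-- A node feature that is a polynomial in the node signal, given simultaneously on all finite
graphs. -/
abbrev NodePoly : Type (u + 1) := ∀ 𝒢 : FinGraph.{u}, 𝒢.V → MvPolynomial 𝒢.V ℝ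

namespace NodePoly

/-- The node signal itself. -/
def input : NodePoly.{u} := fun _ v => X v

/-- One round of message passing: the sum of a feature over the neighbours. -/
def shift (F : NodePoly.{u}) : NodePoly.{u} := fun 𝒢 v => ∑ w, 𝒢.S v w • F 𝒢 w

end NodePoly

open NodePoly

/-- The polynomial node features that can be formed from the node signal by pointwise algebra and
message passing. -/
inductive IsMessagePassing : NodePoly.{u} → Prop
  | algebraMap (r : ℝ) : IsMessagePassing (algebraMap ℝ NodePoly r)
  | input : IsMessagePassing input
  | add {F G} : IsMessagePassing F → IsMessagePassing G → IsMessagePassing (F + G)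
  | mul {F G} : IsMessagePassing F → IsMessagePassing G → IsMessagePassing (F * G)
  | shift {F} : IsMessagePassing F → IsMessagePassing (shift F)

/-- The features satisfying `IsMessagePassing`, as a subalgebra. -/
def messagePassing : Subalgebra ℝ NodePoly.{u} where
  carrier := {F | IsMessagePassing F}
  add_mem' := .add
  mul_mem' := .mul
  algebraMap_mem' := .algebraMap

theorem input_mem_messagePassing : input ∈ messagePassing.{u} := .input

theorem shift_mem_messagePassing {F : NodePoly.{u}} (hF : F ∈ messagePassing) :
    shift F ∈ messagePassing := .shift hF

/-- One of the outputs of `Φ` is the feature `F` of the node signal, on every graph. -/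
def GNN.Computes {p n : ℕ} (Φ : GNN p 1 n) (F : NodePoly.{u}) : Prop :=
  ∃ j, ∀ (𝒢 : FinGraph.{u}) (x : 𝒢.V → ℝ) (v : 𝒢.V), Φ.run 𝒢.graph x v j = aeval x (F 𝒢 v)

theorem exists_computes_input {p : ℕ} (hp : 1 ≤ p) :
    ∃ Φ : GNN p 1 1, Φ.Computes input.{u} := by
  obtain ⟨L, hL⟩ := exists_gnnLayer_of_mem_powerSpan.{u} (m := 1)
    (fun (_ : Fin 1) z => z (Fin.castAdd 1 0)) fun _ => apply_mem_powerSpan hp _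
  refine ⟨.single L, 0, fun 𝒢 x v => ?_⟩
  rw [GNN.run, GNN.apply, hL, Fin.append_left, Matrix.of_apply, input, aeval_X]

theorem GNN.exists_snoc_readout {p n : ℕ} (hp : 1 ≤ p) (Φ : GNN p 1 n)
    {f : (Fin (n + n) → ℝ) → ℝ} (hf : f ∈ powerSpan p (n + n)) :
    ∃ Φ' : GNN p 1 (n + 1), (∀ F : NodePoly.{u}, Φ.Computes F → Φ'.Computes F) ∧
      ∀ (𝒢 : FinGraph.{u}) (x : 𝒢.V → ℝ) (v : 𝒢.V), Φ'.run 𝒢.graph x v (Fin.last n) =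
        f (Fin.append (Φ.run 𝒢.graph x v) fun i => ∑ w, 𝒢.S v w * Φ.run 𝒢.graph x w i) := by
  let readout : Fin (n + 1) → (Fin (n + n) → ℝ) → ℝ :=
    Fin.snoc (fun i z => z (Fin.castAdd n i)) f
  have hreadout (j) : readout j ∈ powerSpan p (n + n) := by
    refine Fin.lastCases ?_ (fun i => ?_) j
    · simpa only [readout, Fin.snoc_last] using hf
    · simpa only [readout, Fin.snoc_castSucc] using apply_mem_powerSpan hp _
  obtain ⟨L, hL⟩ := exists_gnnLayer_of_mem_powerSpan.{u} readout hreadout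
  refine ⟨.snoc Φ L, fun F ⟨j, hj⟩ => ⟨j.castSucc, fun 𝒢 x v => ?_⟩, fun 𝒢 x v => ?_⟩
  · rw [← hj, GNN.run, GNN.apply, hL]
    simp only [readout, Fin.snoc_castSucc, Fin.append_left, GNN.run]
  · rw [GNN.run, GNN.apply, hL]
    simp only [readout, Fin.snoc_last, GNN.run, FinGraph.S]

theorem IsMessagePassing.exists_computes {p : ℕ} (hp : 2 ≤ p) {F : NodePoly.{u}}
    (hF : IsMessagePassing F) {n : ℕ} (Φ : GNN p 1 n) (hΦ : Φ.Computes NodePoly.input.{u}) :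
    ∃ (n' : ℕ) (Φ' : GNN p 1 n'),
      (∀ G : NodePoly.{u}, Φ.Computes G → Φ'.Computes G) ∧ Φ'.Computes F := by
  have hp1 : 1 ≤ p := one_le_two.trans hp
  induction hF generalizing n with
  | algebraMap r =>
    obtain ⟨Φ', hmono, hf⟩ := Φ.exists_snoc_readout hp1
      (Submodule.smul_mem _ r (one_mem_powerSpan p (n + n)))
    exact ⟨_, Φ', hmono, _, fun 𝒢 x v => (hf 𝒢 x v).trans (by simp)⟩
  | input => exact ⟨n, Φ, fun _ h => h, hΦ⟩
  | add _ _ ihF ihG =>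
    obtain ⟨_, Φ₁, hmono₁, hF⟩ := ihF Φ hΦ
    obtain ⟨_, Φ₂, hmono₂, j, hj⟩ := ihG Φ₁ (hmono₁ _ hΦ)
    obtain ⟨i, hi⟩ := hmono₂ _ hF
    obtain ⟨Φ₃, hmono₃, hf⟩ := Φ₂.exists_snoc_readout hp1
      (add_mem (apply_mem_powerSpan hp1 (Fin.castAdd _ i))
        (apply_mem_powerSpan hp1 (Fin.castAdd _ j)))
    exact ⟨_, Φ₃, fun G h => hmono₃ G (hmono₂ G (hmono₁ G h)), _,
      fun 𝒢 x v => (hf 𝒢 x v).trans (by simp [hi, hj])⟩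
  | mul _ _ ihF ihG =>
    obtain ⟨_, Φ₁, hmono₁, hF⟩ := ihF Φ hΦ
    obtain ⟨_, Φ₂, hmono₂, j, hj⟩ := ihG Φ₁ (hmono₁ _ hΦ)
    obtain ⟨i, hi⟩ := hmono₂ _ hF
    obtain ⟨Φ₃, hmono₃, hf⟩ := Φ₂.exists_snoc_readout hp1
      (apply_mul_apply_mem_powerSpan hp (Fin.castAdd _ i) (Fin.castAdd _ j))
    exact ⟨_, Φ₃, fun G h => hmono₃ G (hmono₂ G (hmono₁ G h)), _,
      fun 𝒢 x v => (hf 𝒢 x v).trans (by simp [hi, hj])⟩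
  | shift _ ih =>
    obtain ⟨_, Φ₁, hmono₁, i, hi⟩ := ih Φ hΦ
    obtain ⟨Φ₂, hmono₂, hf⟩ := Φ₁.exists_snoc_readout hp1
      (apply_mem_powerSpan hp1 (Fin.natAdd _ i))
    exact ⟨_, Φ₂, fun G h => hmono₂ G (hmono₁ G h), _, fun 𝒢 x v => (hf 𝒢 x v).trans (by
      simp [hi, NodePoly.shift, -Fin.natAdd_eq_addNat])⟩

theorem exists_gnn_run_eq_aeval {p n : ℕ} (hp : 2 ≤ p) (F : Fin n → NodePoly.{u})
    (hF : ∀ j, F j ∈ messagePassing) : ∃ Φ : GNN p 1 n,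
      ∀ (𝒢 : FinGraph.{u}) (x : 𝒢.V → ℝ) (v : 𝒢.V) (j : Fin n),
        Φ.run 𝒢.graph x v j = aeval x (F j 𝒢 v) := by
  have hp1 : 1 ≤ p := one_le_two.trans hp
  obtain ⟨d, Φ, -, hΦ⟩ : ∃ (d : ℕ) (Φ : GNN p 1 d),
      Φ.Computes input.{u} ∧ ∀ j ∈ Finset.univ, Φ.Computes (F j) := by
    induction (Finset.univ : Finset (Fin n)) using Finset.induction_on with
    | empty =>
      obtain ⟨Φ, hΦ⟩ := exists_computes_input hp1
      exact ⟨1, Φ, hΦ, by simp⟩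
    | insert j s _ ih =>
      obtain ⟨d, Φ, hinput, hΦ⟩ := ih
      obtain ⟨d', Φ', hmono, hj⟩ := (hF j).exists_computes hp Φ hinput
      exact ⟨d', Φ', hmono _ hinput,
        Finset.forall_mem_insert _ _ _ |>.mpr ⟨hj, fun i hi => hmono _ (hΦ i hi)⟩⟩
  choose i hi using fun j => hΦ j (Finset.mem_univ j)
  obtain ⟨L, hL⟩ := exists_gnnLayer_of_mem_powerSpan.{u} (fun j z => z (Fin.castAdd d (i j)))
    fun j => apply_mem_powerSpan hp1 _
  refine ⟨.snoc Φ L, fun 𝒢 x v j => ?_⟩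
  rw [← hi, GNN.run, GNN.apply, hL, Fin.append_left, GNN.run]

section ForestSums

variable {A : Type*}

/-- `T` lists the edges `(parent, child)` of a rooted forest, the most recently attached leaf
first. -/
def IsForest (T : List (A × A)) : Prop :=
  (∀ e ∈ T, e.2 ≠ e.1) ∧ T.Pairwise fun e f => e.2 ≠ f.1 ∧ e.2 ≠ f.2

instance [DecidableEq A] (T : List (A × A)) : Decidable (IsForest T) :=
  inferInstanceAs (Decidable (_ ∧ _))

theorem IsForest.of_cons {e : A × A} {T : List (A × A)} (h : IsForest (e :: T)) : IsForest T :=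
  ⟨fun f hf => h.1 f (List.mem_cons_of_mem _ hf), h.2.of_cons⟩

theorem IsForest.child_ne {p c : A} {T : List (A × A)} (h : IsForest ((p, c) :: T)) :
    ∀ e ∈ T, c ≠ e.1 ∧ c ≠ e.2 :=
  fun _ he => List.rel_of_pairwise_cons h.2 he

variable {V : Type*} (S : Matrix V V ℝ)

/-- The product over the edges in `E` of the weights of their images under `z`. -/
def edgeWeight (E : List (A × A)) (z : A → V) : ℝ := (E.map fun e => S (z e.1) (z e.2)).prod

@[simp] theorem edgeWeight_nil (z : A → V) : edgeWeight S [] z = 1 := rfl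

@[simp] theorem edgeWeight_cons (e : A × A) (E : List (A × A)) (z : A → V) :
    edgeWeight S (e :: E) z = S (z e.1) (z e.2) * edgeWeight S E z := by
  simp [edgeWeight]

theorem edgeWeight_append (E F : List (A × A)) (z : A → V) :
    edgeWeight S (E ++ F) z = edgeWeight S E z * edgeWeight S F z := by
  simp [edgeWeight]

theorem edgeWeight_adjMatrix (G : SimpleGraph V) [DecidableRel G.Adj] (E : List (A × A))
    (z : A → V) :
    edgeWeight (G.adjMatrix ℝ) E z = if ∀ e ∈ E, G.Adj (z e.1) (z e.2) then 1 else 0 := by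
  induction E with
  | nil => simp
  | cons e E ih =>
    simp only [edgeWeight_cons, ih, SimpleGraph.adjMatrix_apply, List.forall_mem_cons, ite_and,
      ite_mul, one_mul, zero_mul]

theorem edgeWeight_update [DecidableEq A] {E : List (A × A)} {c : A}
    (hc : ∀ e ∈ E, c ≠ e.1 ∧ c ≠ e.2) (z : A → V) (y : V) :
    edgeWeight S E (Function.update z c y) = edgeWeight S E z := by
  refine congrArg List.prod (List.map_congr_left fun e he => ?_)
  rw [Function.update_of_ne (hc e he).1.symm, Function.update_of_ne (hc e he).2.symm]

variable [Fintype A] [DecidableEq A] [Fintype V] [DecidableEq V]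

/-- The maps `A → V` that send every vertex which is not a child in `T` to `v`. -/
def placements (T : List (A × A)) (v : V) : Finset (A → V) :=
  {z | ∀ a, a ∉ T.map Prod.snd → z a = v}

theorem mem_placements {T : List (A × A)} {v : V} {z : A → V} :
    z ∈ placements T v ↔ ∀ a, a ∉ T.map Prod.snd → z a = v := by
  simp [placements]

variable {M : Type*} [AddCommMonoid M] [Module ℝ M]

/-- The sum of `φ z` over the placements `z` of `T` that send the roots to `v`, weighted by the
edges of `T`. -/
def forestSum (T : List (A × A)) (v : V) : ((A → V) → M) →ₗ[ℝ] M :=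
  ∑ z ∈ placements T v, edgeWeight S T z • LinearMap.proj z

theorem forestSum_apply (T : List (A × A)) (v : V) (φ : (A → V) → M) :
    forestSum S T v φ = ∑ z ∈ placements T v, edgeWeight S T z • φ z := by
  simp [forestSum]

theorem forestSum_nil (v : V) (φ : (A → V) → M) : forestSum S [] v φ = φ fun _ => v := by
  have : placements ([] : List (A × A)) v = {fun _ => v} := by
    ext z
    simp [mem_placements, funext_iff]
  simp [forestSum_apply, this]

theorem forestSum_cons {p c : A} {T : List (A × A)} (hT : IsForest ((p, c) :: T)) (v : V)
    (φ : (A → V) → M) :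
    forestSum S ((p, c) :: T) v φ =
      forestSum S T v fun x => ∑ y, S (x p) y • φ (Function.update x c y) := by
  have hp : p ≠ c := (hT.1 (p, c) List.mem_cons_self).symm
  have hc : c ∉ T.map Prod.snd := fun h => by
    obtain ⟨e, he, rfl⟩ := List.mem_map.mp h
    exact (hT.child_ne e he).2 rfl
  simp only [forestSum_apply, Finset.smul_sum, smul_smul, Finset.sum_sigma']
  refine Finset.sum_nbij' (fun z => ⟨Function.update z c v, z c⟩)
    (fun x => Function.update x.1 c x.2) ?_ ?_ ?_ ?_ ?_
  · intro z hz
    rw [mem_placements] at hz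
    simp only [Finset.mem_sigma, mem_placements, Finset.mem_univ, and_true]
    intro a ha
    obtain rfl | hac := eq_or_ne a c
    · simp
    · rw [Function.update_of_ne hac]
      exact hz a (by simp [hac, ha])
  · rintro ⟨x, y⟩ hx
    simp only [Finset.mem_sigma, mem_placements, Finset.mem_univ, and_true] at hx
    rw [mem_placements]
    intro a ha
    rw [List.map_cons, List.mem_cons, not_or] at ha
    rw [Function.update_of_ne ha.1]
    exact hx a ha.2
  · intro z _
    simp
  · rintro ⟨x, y⟩ hx
    simp only [Finset.mem_sigma, mem_placements, Finset.mem_univ, and_true] at hx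
    simp [← hx c hc]
  · intro z _
    simp [edgeWeight_update S hT.child_ne, Function.update_of_ne hp, mul_comm]

theorem forestSum_congr (G : SimpleGraph V) [DecidableRel G.Adj] {T : List (A × A)}
    {φ ψ : (A → V) → M} (h : ∀ z, (∀ e ∈ T, G.Adj (z e.1) (z e.2)) → φ z = ψ z) (v : V) :
    forestSum (G.adjMatrix ℝ) T v φ = forestSum (G.adjMatrix ℝ) T v ψ := by
  simp only [forestSum_apply, edgeWeight_adjMatrix, ite_smul, one_smul, zero_smul]
  exact Finset.sum_congr rfl fun z _ => by
    split_ifs with hz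
    exacts [h z hz, rfl]

end ForestSums

/-- A polynomial in the node signal that depends on the images of the labels in `A`. -/
abbrev SlotPoly (A : Type*) := ∀ 𝒢 : FinGraph.{u}, (A → 𝒢.V) → MvPolynomial 𝒢.V ℝ

section Slots

variable {A : Type*}

/-- The feature `F` read off at the image of `a`. -/
def slot (a : A) (F : NodePoly.{u}) : SlotPoly.{u} A := fun 𝒢 x => F 𝒢 (x a)

/-- The algebra generated by the message passing features of the images of the labels. -/
def slotAlgebra (A : Type*) : Subalgebra ℝ (SlotPoly.{u} A) :=
  Algebra.adjoin ℝ {Ψ | ∃ a, ∃ F ∈ messagePassing, slot a F = Ψ}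

theorem slot_mem_slotAlgebra (a : A) {F : NodePoly.{u}} (hF : F ∈ messagePassing) :
    slot a F ∈ slotAlgebra A :=
  Algebra.subset_adjoin ⟨a, F, hF, rfl⟩

variable [Fintype A]

theorem slotAlgebra_toSubmodule_le_span : (slotAlgebra A).toSubmodule ≤ Submodule.span ℝ
    {Ψ : SlotPoly.{u} A | ∃ F : A → NodePoly.{u}, (∀ a, F a ∈ messagePassing) ∧
      ∏ a, slot a (F a) = Ψ} := by
  classical
  rw [slotAlgebra, Algebra.adjoin_eq_span]
  refine Submodule.span_mono fun Ψ hΨ => ?_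
  induction hΨ using Submonoid.closure_induction with
  | mem Ψ hΨ =>
    obtain ⟨a, F, hF, rfl⟩ := hΨ
    refine ⟨fun b => if b = a then F else 1, fun b => ?_, ?_⟩
    · dsimp only
      split_ifs
      exacts [hF, one_mem _]
    · rw [Finset.prod_eq_single a]
      · simp only [if_pos]
      · intro b _ hb
        simp only [if_neg hb]
        rfl
      · simp
  | one => exact ⟨1, fun _ => one_mem _, Finset.prod_eq_one fun _ _ => rfl⟩
  | mul Φ Ψ _ _ hΦ hΨ =>
    obtain ⟨F, hF, rfl⟩ := hΦ
    obtain ⟨G, hG, rfl⟩ := hΨ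
    exact ⟨F * G, fun a => mul_mem (hF a) (hG a), Finset.prod_mul_distrib⟩

variable [DecidableEq A]

theorem forestSum_prod_slot_mem_messagePassing {T : List (A × A)} (hT : IsForest T)
    {F : A → NodePoly.{u}} (hF : ∀ a, F a ∈ messagePassing) :
    (fun 𝒢 v => forestSum 𝒢.S T v ((∏ a, slot a (F a) : SlotPoly.{u} A) 𝒢)) ∈
      messagePassing := by
  induction T generalizing F with
  | nil =>
    convert prod_mem (S := messagePassing) fun a (_ : a ∈ Finset.univ) => hF a using 1
    funext 𝒢 v
    simp [forestSum_nil, slot]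
  | cons e T ih =>
    obtain ⟨p, c⟩ := e
    -- The leaf is absorbed into the feature of its parent.
    let F' (a : A) : NodePoly.{u} :=
      (if a = c then 1 else F a) * if a = p then shift (F c) else 1
    have hF' (a) : F' a ∈ messagePassing := by
      refine mul_mem ?_ ?_ <;> split_ifs
      exacts [one_mem _, hF a, shift_mem_messagePassing (hF c), one_mem _]
    convert ih hT.of_cons hF' using 3 with 𝒢 v
    rw [forestSum_cons _ hT]
    congr 1
    funext x
    have hleaf (y : 𝒢.V) : (∏ a, F a 𝒢 (Function.update x c y a)) =
        (∏ a, (if a = c then 1 else F a) 𝒢 (x a)) * F c 𝒢 y := by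
      rw [← Finset.mul_prod_erase _ _ (Finset.mem_univ c), Function.update_self, mul_comm,
        ← Finset.mul_prod_erase _ _ (Finset.mem_univ c), if_pos rfl, Pi.one_apply, Pi.one_apply,
        one_mul]
      congr 1
      refine Finset.prod_congr rfl fun a ha => ?_
      rw [Function.update_of_ne (Finset.ne_of_mem_erase ha), if_neg (Finset.ne_of_mem_erase ha)]
    have hparent : (∏ a, (if a = p then shift (F c) else 1) 𝒢 (x a)) = shift (F c) 𝒢 (x p) := by
      rw [Finset.prod_eq_single p (fun a _ ha => by rw [if_neg ha]; rfl) (by simp), if_pos rfl]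
    simp only [Finset.prod_apply, slot, hleaf, F', Pi.mul_apply, Finset.prod_mul_distrib, hparent,
      shift, Finset.mul_sum, mul_smul_comm]

theorem forestSum_mem_messagePassing {T : List (A × A)} (hT : IsForest T) {Ψ : SlotPoly.{u} A}
    (hΨ : Ψ ∈ slotAlgebra A) : (fun 𝒢 v => forestSum 𝒢.S T v (Ψ 𝒢)) ∈ messagePassing := by
  have hspan := slotAlgebra_toSubmodule_le_span hΨ
  clear hΨ
  induction hspan using Submodule.span_induction with
  | mem Ψ h =>
    obtain ⟨F, hF, rfl⟩ := h
    exact forestSum_prod_slot_mem_messagePassing hT hF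
  | zero =>
    simp only [Pi.zero_apply, map_zero]
    exact zero_mem messagePassing
  | add Φ Ψ _ _ hΦ hΨ =>
    simp only [Pi.add_apply, map_add]
    exact add_mem hΦ hΨ
  | smul r Ψ _ hΨ =>
    simp only [Pi.smul_apply, map_smul]
    exact Subalgebra.smul_mem _ hΨ r

end Slots

section Attainable

/-- A linear functional on the polynomials in the node signal, given on all finite graphs. -/
abbrev SignalFunctional : Type (u + 1) := ∀ 𝒢 : FinGraph.{u}, MvPolynomial 𝒢.V ℝ →ₗ[ℝ] ℝ

variable {A : Type*} [Fintype A] [DecidableEq A] (L : SignalFunctional.{u})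

/-- The node invariants obtained by applying `L` to a message passing feature. -/
def attainable : Submodule ℝ (∀ 𝒢 : FinGraph.{u}, 𝒢.V → ℝ) :=
  messagePassing.toSubmodule.map <| LinearMap.pi fun 𝒢 => LinearMap.pi fun v =>
    L 𝒢 ∘ₗ LinearMap.proj v ∘ₗ LinearMap.proj 𝒢

/-- The functions of the images of the labels whose sum over the placements of `T` is
attainable. -/
def treeAttainable (T : List (A × A)) :
    Submodule ℝ (∀ 𝒢 : FinGraph.{u}, (A → 𝒢.V) → ℝ) :=
  (attainable L).comap <| LinearMap.pi fun 𝒢 => LinearMap.pi fun v =>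
    forestSum 𝒢.S T v ∘ₗ LinearMap.proj 𝒢

variable {L}

theorem mem_attainable {f : ∀ 𝒢 : FinGraph.{u}, 𝒢.V → ℝ} :
    f ∈ attainable L ↔ ∃ F ∈ messagePassing, ∀ 𝒢 v, L 𝒢 (F 𝒢 v) = f 𝒢 v := by
  simp only [attainable, Submodule.mem_map, funext_iff]
  rfl

theorem mem_treeAttainable {T : List (A × A)} {f : ∀ 𝒢 : FinGraph.{u}, (A → 𝒢.V) → ℝ} :
    f ∈ treeAttainable L T ↔ (fun 𝒢 v => forestSum 𝒢.S T v (f 𝒢)) ∈ attainable L :=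
  Iff.rfl

theorem mem_treeAttainable_of_slotAlgebra {T : List (A × A)} (hT : IsForest T)
    {Ψ : SlotPoly.{u} A} (hΨ : Ψ ∈ slotAlgebra A) {f : ∀ 𝒢 : FinGraph.{u}, (A → 𝒢.V) → ℝ}
    (h : ∀ 𝒢 x, (∀ e ∈ T, 𝒢.graph.Adj (x e.1) (x e.2)) → L 𝒢 (Ψ 𝒢 x) = f 𝒢 x) :
    f ∈ treeAttainable L T := by
  refine mem_attainable.mpr ⟨_, forestSum_mem_messagePassing hT hΨ, fun 𝒢 v => ?_⟩
  refine Eq.trans ?_ (forestSum_congr 𝒢.graph (h 𝒢) v)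
  simp only [forestSum_apply, map_sum, map_smul, FinGraph.S]

theorem mem_treeAttainable_cons {p c : A} {T : List (A × A)} (hT : IsForest ((p, c) :: T))
    {f : ∀ 𝒢 : FinGraph.{u}, (A → 𝒢.V) → ℝ} :
    f ∈ treeAttainable L ((p, c) :: T) ↔
      (fun 𝒢 x => ∑ y, 𝒢.S (x p) y * f 𝒢 (Function.update x c y)) ∈ treeAttainable L T := by
  simp only [mem_treeAttainable, forestSum_cons _ hT, smul_eq_mul]

end Attainable

section BasisFunctional

/-- The sum of the values of a polynomial at the standard basis vectors. -/
def basisFunctional (V : Type*) [Fintype V] [DecidableEq V] : MvPolynomial V ℝ →ₗ[ℝ] ℝ :=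
  ∑ m, (aeval (Pi.single m 1 : V → ℝ)).toLinearMap

variable {A : Type*} [Fintype A] [DecidableEq A]

theorem star_mem_treeAttainable {T ex : List (A × A)} (hT : IsForest T) {m : A}
    (hm : ∀ e ∈ ex, e.2 = m) :
    (fun 𝒢 => edgeWeight 𝒢.S ex) ∈
      treeAttainable (fun 𝒢 : FinGraph.{u} => basisFunctional 𝒢.V) T := by
  have hinput := input_mem_messagePassing.{u}
  refine mem_treeAttainable_of_slotAlgebra hT (Ψ := slot m input *
    (ex.map fun e => slot e.1 (shift input)).prod) (mul_mem (slot_mem_slotAlgebra m hinput)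
    (list_prod_mem fun Ψ hΨ => ?_)) fun 𝒢 x _ => ?_
  · obtain ⟨e, -, rfl⟩ := List.mem_map.mp hΨ
    exact slot_mem_slotAlgebra _ (shift_mem_messagePassing hinput)
  have hsingle (y : 𝒢.V) : aeval (Pi.single y 1 : 𝒢.V → ℝ)
      ((ex.map fun e => slot e.1 (shift input)).prod 𝒢 x) =
        (ex.map fun e => 𝒢.S (x e.1) y).prod := by
    induction ex with
    | nil => exact map_one _
    | cons e ex ih =>
      rw [List.forall_mem_cons] at hm
      simp only [List.map_cons, List.prod_cons, Pi.mul_apply, map_mul, ih hm.2]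
      simp [slot, shift, input, Pi.single_apply]
  have hedge : (ex.map fun e => 𝒢.S (x e.1) (x m)).prod = edgeWeight 𝒢.S ex x :=
    congrArg List.prod (List.map_congr_left fun e he => by rw [hm e he])
  have hroot : (slot m input : SlotPoly A) 𝒢 x = X (x m) := rfl
  simp only [basisFunctional, LinearMap.sum_apply, AlgHom.toLinearMap_apply, Pi.mul_apply, map_mul,
    hsingle, hroot, aeval_X, Pi.single_apply, ite_mul, one_mul, zero_mul, Finset.sum_ite_eq,
    Finset.mem_univ, if_true, hedge]

end BasisFunctional

section Moments

variable {V : Type*}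

/-- The expectation of a polynomial in independent random variables with moments `M`. -/
def momentFunctional [Fintype V] (M : ℕ → ℝ) : MvPolynomial V ℝ →ₗ[ℝ] ℝ :=
  (basisMonomials V ℝ).constr ℝ fun s => ∏ i, M (s i)

/-- The values that standardization prescribes for the moments. -/
structure IsStandardized (M : ℕ → ℝ) : Prop where
  zero : M 0 = 1
  one : M 1 = 0
  two : M 2 = 1

theorem sum_smul_X_mem_supported {s : Finset V} {a : V} {c : V → ℝ}
    (h : ∀ i ∈ s, c i = 0 ∨ i ≠ a) :
    ∑ i ∈ s, c i • X i ∈ supported ℝ {a}ᶜ := by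
  refine sum_mem fun i hi => ?_
  obtain hc | hia := h i hi
  · simp [hc]
  · exact Subalgebra.smul_mem _ (X_mem_supported.mpr hia) _

variable [Fintype V] {M : ℕ → ℝ}

theorem momentFunctional_monomial (s : V →₀ ℕ) (c : ℝ) :
    momentFunctional M (monomial s c) = c * ∏ i, M (s i) := by
  have h : monomial s c = c • basisMonomials V ℝ s := by simp [smul_monomial]
  rw [h, map_smul, momentFunctional, Module.Basis.constr_basis, smul_eq_mul]

theorem momentFunctional_X_pow_mul (hM : M 0 = 1) {a : V} (k : ℕ) {P : MvPolynomial V ℝ}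
    (hP : P ∈ supported ℝ {a}ᶜ) :
    momentFunctional M (X a ^ k * P) = M k * momentFunctional M P := by
  classical
  conv_lhs => rw [P.as_sum]
  conv_rhs => rw [P.as_sum]
  simp only [Finset.mul_sum, map_sum]
  refine Finset.sum_congr rfl fun s hs => ?_
  have hsa : s a = 0 := by
    by_contra h
    exact mem_supported.mp hP
      ((mem_vars_iff_mem_support a).mpr ⟨s, hs, Finsupp.mem_support_iff.mpr h⟩) rfl
  have herase : ∏ i ∈ Finset.univ.erase a, M ((Finsupp.single a k + s) i) =
      ∏ i ∈ Finset.univ.erase a, M (s i) := Finset.prod_congr rfl fun i hi => by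
    simp [Finsupp.single_eq_of_ne (Finset.ne_of_mem_erase hi)]
  rw [X_pow_eq_monomial, monomial_mul, momentFunctional_monomial, momentFunctional_monomial,
    ← Finset.mul_prod_erase _ _ (Finset.mem_univ a), herase,
    ← Finset.mul_prod_erase _ (fun i => M (s i)) (Finset.mem_univ a), Finsupp.add_apply,
    Finsupp.single_eq_same, hsa, hM, add_zero]
  ring

theorem momentFunctional_one (hM : M 0 = 1) : momentFunctional M (1 : MvPolynomial V ℝ) = 1 := by
  simpa [hM] using momentFunctional_monomial (M := M) (0 : V →₀ ℕ) 1

section Expansion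

variable {a : V} {P Q R T : MvPolynomial V ℝ} (p q r t : ℝ)

theorem momentFunctional_mul₂_add (hM : IsStandardized M) (hP : P ∈ supported ℝ {a}ᶜ)
    (hQ : Q ∈ supported ℝ {a}ᶜ) :
    momentFunctional M ((p • X a + P) * (q • X a + Q)) = p * q + momentFunctional M (P * Q) := by
  have hexpand : (p • X a + P) * (q • X a + Q) =
      (p * q) • (X a ^ 2 * 1) + p • (X a ^ 1 * Q) + q • (X a ^ 1 * P) + P * Q := by
    simp only [smul_eq_C_mul, map_mul]
    ring
  simp only [hexpand, map_add, map_smul, smul_eq_mul, momentFunctional_X_pow_mul hM.zero, hP, hQ,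
    one_mem, momentFunctional_one hM.zero, hM.one, hM.two]
  ring

theorem momentFunctional_mul₃_add (hM : IsStandardized M) (hP : P ∈ supported ℝ {a}ᶜ)
    (hQ : Q ∈ supported ℝ {a}ᶜ) (hR : R ∈ supported ℝ {a}ᶜ) :
    momentFunctional M ((p • X a + P) * (q • X a + Q) * (r • X a + R)) =
      p * q * r * M 3 + p * q * momentFunctional M R + p * r * momentFunctional M Q +
        q * r * momentFunctional M P + momentFunctional M (P * Q * R) := by
  have hexpand : (p • X a + P) * (q • X a + Q) * (r • X a + R) =
      (p * q * r) • (X a ^ 3 * 1) + (p * q) • (X a ^ 2 * R) + (p * r) • (X a ^ 2 * Q) +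
        (q * r) • (X a ^ 2 * P) + p • (X a ^ 1 * (Q * R)) + q • (X a ^ 1 * (P * R)) +
        r • (X a ^ 1 * (P * Q)) + P * Q * R := by
    simp only [smul_eq_C_mul, map_mul]
    ring
  simp only [hexpand, map_add, map_smul, smul_eq_mul, momentFunctional_X_pow_mul hM.zero, hP, hQ,
    hR, mul_mem, one_mem, momentFunctional_one hM.zero, hM.one, hM.two]
  ring

theorem momentFunctional_mul₄_add (hM : IsStandardized M) (hP : P ∈ supported ℝ {a}ᶜ)
    (hQ : Q ∈ supported ℝ {a}ᶜ) (hR : R ∈ supported ℝ {a}ᶜ) (hT : T ∈ supported ℝ {a}ᶜ) :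
    momentFunctional M ((p • X a + P) * (q • X a + Q) * (r • X a + R) * (t • X a + T)) =
      p * q * r * t * M 4 + M 3 * (p * q * r * momentFunctional M T +
        p * q * t * momentFunctional M R + p * r * t * momentFunctional M Q +
        q * r * t * momentFunctional M P) +
      p * q * momentFunctional M (R * T) + p * r * momentFunctional M (Q * T) +
      p * t * momentFunctional M (Q * R) + q * r * momentFunctional M (P * T) +
      q * t * momentFunctional M (P * R) + r * t * momentFunctional M (P * Q) +
      momentFunctional M (P * Q * R * T) := by
  have hexpand : (p • X a + P) * (q • X a + Q) * (r • X a + R) * (t • X a + T) =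
      (p * q * r * t) • (X a ^ 4 * 1) + (p * q * r) • (X a ^ 3 * T) +
      (p * q * t) • (X a ^ 3 * R) + (p * r * t) • (X a ^ 3 * Q) + (q * r * t) • (X a ^ 3 * P) +
      (p * q) • (X a ^ 2 * (R * T)) + (p * r) • (X a ^ 2 * (Q * T)) +
      (p * t) • (X a ^ 2 * (Q * R)) + (q * r) • (X a ^ 2 * (P * T)) +
      (q * t) • (X a ^ 2 * (P * R)) + (r * t) • (X a ^ 2 * (P * Q)) +
      p • (X a ^ 1 * (Q * R * T)) + q • (X a ^ 1 * (P * R * T)) +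
      r • (X a ^ 1 * (P * Q * T)) + t • (X a ^ 1 * (P * Q * R)) + P * Q * R * T := by
    simp only [smul_eq_C_mul, map_mul]
    ring
  simp only [hexpand, map_add, map_smul, smul_eq_mul, momentFunctional_X_pow_mul hM.zero, hP, hQ,
    hR, hT, mul_mem hP hQ, mul_mem hP hR, mul_mem hQ hR, mul_mem, one_mem,
    momentFunctional_one hM.zero, hM.one, hM.two]
  ring

end Expansion

section LinearForms

variable (b c d e : V → ℝ)

theorem momentFunctional_sum (hM : IsStandardized M) (s : Finset V) :
    momentFunctional M (∑ i ∈ s, b i • X i) = 0 := by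
  refine (map_sum _ _ _).trans (Finset.sum_eq_zero fun i _ => ?_)
  have hX := momentFunctional_X_pow_mul hM.zero (a := i) 1 (one_mem _)
  rw [map_smul, show (X i : MvPolynomial V ℝ) = X i ^ 1 * 1 by ring, hX, hM.one, zero_mul,
    smul_zero]

theorem momentFunctional_sum_mul_sum (hM : IsStandardized M) (s : Finset V) :
    momentFunctional M ((∑ i ∈ s, b i • X i) * ∑ i ∈ s, c i • X i) = ∑ i ∈ s, b i * c i := by
  induction s using Finset.cons_induction with
  | empty => simp
  | cons a s ha ih =>
    have hs (f : V → ℝ) : ∑ i ∈ s, f i • X i ∈ supported ℝ {a}ᶜ :=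
      sum_smul_X_mem_supported fun i hi => .inr (ne_of_mem_of_not_mem hi ha)
    simp only [Finset.sum_cons, momentFunctional_mul₂_add _ _ hM (hs _) (hs _), ih]

theorem momentFunctional_sum_mul₃ (hM : IsStandardized M) (s : Finset V) :
    momentFunctional M ((∑ i ∈ s, b i • X i) * (∑ i ∈ s, c i • X i) * ∑ i ∈ s, d i • X i) =
      M 3 * ∑ i ∈ s, b i * c i * d i := by
  induction s using Finset.cons_induction with
  | empty => simp
  | cons a s ha ih =>
    have hs (f : V → ℝ) : ∑ i ∈ s, f i • X i ∈ supported ℝ {a}ᶜ :=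
      sum_smul_X_mem_supported fun i hi => .inr (ne_of_mem_of_not_mem hi ha)
    simp only [Finset.sum_cons, momentFunctional_mul₃_add _ _ _ hM (hs _) (hs _) (hs _), ih,
      momentFunctional_sum _ hM]
    ring

theorem momentFunctional_sum_mul₄ (hM : IsStandardized M) (s : Finset V) :
    momentFunctional M ((∑ i ∈ s, b i • X i) * (∑ i ∈ s, c i • X i) * (∑ i ∈ s, d i • X i) *
        ∑ i ∈ s, e i • X i) =
      (∑ i ∈ s, b i * c i) * ∑ i ∈ s, d i * e i + (∑ i ∈ s, b i * d i) * ∑ i ∈ s, c i * e i +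
        (∑ i ∈ s, b i * e i) * ∑ i ∈ s, c i * d i +
        (M 4 - 3) * ∑ i ∈ s, b i * c i * d i * e i := by
  induction s using Finset.cons_induction with
  | empty => simp
  | cons a s ha ih =>
    have hs (f : V → ℝ) : ∑ i ∈ s, f i • X i ∈ supported ℝ {a}ᶜ :=
      sum_smul_X_mem_supported fun i hi => .inr (ne_of_mem_of_not_mem hi ha)
    simp only [Finset.sum_cons, momentFunctional_mul₄_add _ _ _ _ hM (hs _) (hs _) (hs _) (hs _),
      ih, momentFunctional_sum_mul_sum _ _ hM, momentFunctional_sum _ hM]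
    ring

end LinearForms

variable {a b : V}

theorem X_eq_sum_single [DecidableEq V] (a : V) :
    (X a : MvPolynomial V ℝ) = ∑ i, (Pi.single a 1 : V → ℝ) i • X i := by
  simp [Pi.single_apply]

theorem momentFunctional_X_mul_sum (hM : IsStandardized M) (c : V → ℝ) (a : V) :
    momentFunctional M (X a * ∑ i, c i • X i) = c a := by
  classical
  rw [X_eq_sum_single, momentFunctional_sum_mul_sum _ _ hM]
  simp [Pi.single_apply]

theorem momentFunctional_X_mul_X_mul_sum_mul_sum (hM : IsStandardized M) (c d : V → ℝ)
    (hab : a ≠ b) :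
    momentFunctional M (X a * X b * (∑ i, c i • X i) * ∑ i, d i • X i) =
      c a * d b + d a * c b := by
  classical
  rw [X_eq_sum_single a, X_eq_sum_single b, momentFunctional_sum_mul₄ _ _ _ _ hM]
  simp [Pi.single_apply, hab.symm, mul_comm]

section Book

variable {u y : V → ℝ}

theorem sum_smul_X_mem_supported_of_eq_zero (hu : u a = 0) :
    ∑ i, u i • X i ∈ supported ℝ {a}ᶜ :=
  sum_smul_X_mem_supported fun _ _ => or_iff_not_imp_right.mpr fun h => not_not.mp h ▸ hu

theorem momentFunctional_X_mul_mul_sq (hM : IsStandardized M) (s : ℝ) (hu : u a = 0)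
    (hy : y a = 0) :
    momentFunctional M (X a * (∑ i, u i • X i) * (s • X a + ∑ i, y i • X i) ^ 2) =
      2 * s * ∑ i, u i * y i := by
  have hU := sum_smul_X_mem_supported_of_eq_zero hu
  have hY := sum_smul_X_mem_supported_of_eq_zero hy
  have hexpand (U Y : MvPolynomial V ℝ) : X a * U * (s • X a + Y) ^ 2 =
      s ^ 2 • (X a ^ 3 * U) + (2 * s) • (X a ^ 2 * (U * Y)) + X a ^ 1 * (U * Y * Y) := by
    simp only [smul_eq_C_mul, map_mul, map_pow, map_ofNat]
    ring
  simp only [hexpand, map_add, map_smul, smul_eq_mul, momentFunctional_X_pow_mul hM.zero, hU,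
    mul_mem hU hY, mul_mem (mul_mem hU hY) hY, momentFunctional_sum _ hM,
    momentFunctional_sum_mul_sum _ _ hM, hM.one, hM.two]
  ring

theorem momentFunctional_X_mul_sq_mul_cube (hM : IsStandardized M) (s : ℝ) (hu : u a = 0)
    (hy : y a = 0) :
    momentFunctional M (X a * (∑ i, u i • X i) ^ 2 * (s • X a + ∑ i, y i • X i) ^ 3) =
      3 * s * ((∑ i, u i * u i) * (∑ i, y i * y i) + 2 * (∑ i, u i * y i) ^ 2 +
        (M 4 - 3) * ∑ i, u i * u i * y i * y i) +
      3 * s ^ 2 * M 3 ^ 2 * (∑ i, u i * u i * y i) + s ^ 3 * M 4 * ∑ i, u i * u i := by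
  have hU := sum_smul_X_mem_supported_of_eq_zero hu
  have hY := sum_smul_X_mem_supported_of_eq_zero hy
  have hUUY := mul_mem (mul_mem hU hU) hY
  have hUUYY := mul_mem hUUY hY
  have hexpand (U Y : MvPolynomial V ℝ) : X a * U ^ 2 * (s • X a + Y) ^ 3 =
      s ^ 3 • (X a ^ 4 * (U * U)) + (3 * s ^ 2) • (X a ^ 3 * (U * U * Y)) +
        (3 * s) • (X a ^ 2 * (U * U * Y * Y)) + X a ^ 1 * (U * U * Y * Y * Y) := by
    simp only [smul_eq_C_mul, map_mul, map_pow, map_ofNat]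
    ring
  simp only [hexpand, map_add, map_smul, smul_eq_mul, momentFunctional_X_pow_mul hM.zero,
    mul_mem hU hU, hUUY, hUUYY, mul_mem hUUYY hY, momentFunctional_sum_mul_sum _ _ hM,
    momentFunctional_sum_mul₃ _ _ _ hM, momentFunctional_sum_mul₄ _ _ _ _ hM, hM.one, hM.two]
  ring

/-- A polynomial whose expectation counts, for a node `a` adjacent to `u`, the pairs of common
neighbours of `u` and `w` if `a` is adjacent to `w`: see `momentFunctional_bookPoly`. Here `x` is
the signal at `a`, `U` and `Y` are its sums over the neighbours of `u` and `w`, and `du`, `dw` are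
the degrees of `u` and `w`. -/
def bookPoly {R : Type*} [CommRing R] [Algebra ℝ R] (M : ℕ → ℝ) (x U Y du dw : R) : R :=
  (1 / 6 : ℝ) • (x * (U - x) ^ 2 * Y ^ 3) +
    (1 - (M 4 - 3 + M 3 ^ 2) / 4) • (x * (U - x) * Y ^ 2) +
    x * Y * (1 - (du - 1) * ((1 / 2 : ℝ) • (dw - 1) + algebraMap ℝ _ (M 4 / 6)))

theorem momentFunctional_bookPoly_of_eq_zero (hM : IsStandardized M) {s : ℝ} (hs : s * s = s)
    (hu : ∀ i, u i * u i = u i) (hy : ∀ i, y i * y i = y i) (hua : u a = 0) (hya : y a = 0) :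
    momentFunctional M (bookPoly M (X a) (X a + ∑ i, u i • X i) (s • X a + ∑ i, y i • X i)
      (algebraMap ℝ _ (1 + ∑ i, u i)) (algebraMap ℝ _ (s + ∑ i, y i))) =
      s * (s + ∑ i, u i * y i) ^ 2 := by
  have hedge : momentFunctional M (X a * (s • X a + ∑ i, y i • X i)) = s := by
    have h := momentFunctional_mul₂_add (P := 0) 1 s hM (zero_mem _)
      (sum_smul_X_mem_supported_of_eq_zero hya)
    simpa only [one_smul, add_zero, zero_mul, map_zero, one_mul] using h
  have hscalar (P : MvPolynomial V ℝ) (r t : ℝ) :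
      P * (1 - (algebraMap ℝ _ (1 + r) - 1) * ((1 / 2 : ℝ) • (algebraMap ℝ _ (s + t) - 1) +
        algebraMap ℝ _ (M 4 / 6))) = (1 - r * (1 / 2 * (s + t - 1) + M 4 / 6)) • P := by
    simp only [Algebra.smul_def, map_sub, map_mul, map_add, map_one]
    ring
  have huy (i) : u i * y i * y i = u i * y i := by rw [mul_assoc, hy]
  rw [bookPoly, hscalar]
  simp only [add_sub_cancel_left, map_add, map_smul, smul_eq_mul, hedge,
    momentFunctional_X_mul_mul_sq hM s hua hya, momentFunctional_X_mul_sq_mul_cube hM s hua hya,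
    hu, hy, huy]
  linear_combination (M 3 ^ 2 / 2 * ∑ i, u i * y i - 2 * ∑ i, u i * y i -
    (∑ i, u i) / 2 + (s + 1) * (M 4 / 6 * ∑ i, u i - 1)) * hs

theorem momentFunctional_bookPoly (hM : IsStandardized M) (hu : ∀ i, u i * u i = u i)
    (hy : ∀ i, y i * y i = y i) (ha : u a = 1) :
    momentFunctional M (bookPoly M (X a) (∑ i, u i • X i) (∑ i, y i • X i)
      (∑ i, u i • 1) (∑ i, y i • 1)) = y a * (∑ i, u i * y i) ^ 2 := by
  classical
  -- The summand at `a` of every sum over neighbours is split off.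
  let u' (i : V) : ℝ := u i - (Pi.single a 1 : V → ℝ) i
  let y' (i : V) : ℝ := y i - y a * (Pi.single a 1 : V → ℝ) i
  have hu' (i) : u' i * u' i = u' i := by
    obtain rfl | h := eq_or_ne i a <;> simp [u', *]
  have hy' (i) : y' i * y' i = y' i := by
    obtain rfl | h := eq_or_ne i a <;> simp [y', *]
  have hU : ∑ i, u i • (X i : MvPolynomial V ℝ) = X a + ∑ i, u' i • X i := by
    simp [u', sub_smul, Pi.single_apply]
  have hY : ∑ i, y i • (X i : MvPolynomial V ℝ) = y a • X a + ∑ i, y' i • X i := by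
    simp [y', sub_smul, Pi.single_apply]
  have hdu : ∑ i, u i • (1 : MvPolynomial V ℝ) = algebraMap ℝ _ (1 + ∑ i, u' i) := by
    simp [u', Algebra.smul_def]
  have hdw : ∑ i, y i • (1 : MvPolynomial V ℝ) = algebraMap ℝ _ (y a + ∑ i, y' i) := by
    simp [y', ← Finset.mul_sum, Algebra.smul_def]
  have hcommon : y a + ∑ i, u' i * y' i = ∑ i, u i * y i := by
    simp [u', y', sub_mul, mul_sub, Pi.single_apply, ha]
  rw [hU, hY, hdu, hdw, momentFunctional_bookPoly_of_eq_zero hM (hy a) hu' hy' (by simp [u', ha])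
    (by simp [y']), hcommon]

end Book

end Moments

section MomentRules

variable {A : Type*} {M : ℕ → ℝ} {T : List (A × A)}

/-- Some edge in the list `E` has the ends `a` and `b`. -/
def Linked (E : List (A × A)) (a b : A) : Prop := (a, b) ∈ E ∨ (b, a) ∈ E

instance [DecidableEq A] (E : List (A × A)) (a b : A) : Decidable (Linked E a b) :=
  inferInstanceAs (Decidable (_ ∨ _))

theorem Linked.adj {V : Type*} {G : SimpleGraph V} {x : A → V} {a b : A} (h : Linked T a b)
    (hx : ∀ e ∈ T, G.Adj (x e.1) (x e.2)) : G.Adj (x a) (x b) :=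
  h.elim (fun h => hx _ h) fun h => (hx _ h).symm

theorem FinGraph.S_eq_one {𝒢 : FinGraph.{u}} {v w : 𝒢.V} (h : 𝒢.graph.Adj v w) : 𝒢.S v w = 1 :=
  if_pos h

theorem FinGraph.S_comm (𝒢 : FinGraph.{u}) (v w : 𝒢.V) : 𝒢.S v w = 𝒢.S w v :=
  (𝒢.graph.isSymm_adjMatrix (α := ℝ)).apply w v

theorem FinGraph.S_mul_self (𝒢 : FinGraph.{u}) (v w : 𝒢.V) : 𝒢.S v w * 𝒢.S v w = 𝒢.S v w := by
  simp [FinGraph.S]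

variable [Fintype A] [DecidableEq A]

theorem nil_mem_treeAttainable (hM : IsStandardized M) (hT : IsForest T) :
    (fun 𝒢 => edgeWeight 𝒢.S []) ∈
      treeAttainable (fun 𝒢 : FinGraph.{u} => momentFunctional (V := 𝒢.V) M) T :=
  mem_treeAttainable_of_slotAlgebra hT (one_mem _) fun _ _ _ => momentFunctional_one hM.zero

theorem singleton_mem_treeAttainable (hM : IsStandardized M) (hT : IsForest T) (a b : A) :
    (fun 𝒢 => edgeWeight 𝒢.S [(a, b)]) ∈
      treeAttainable (fun 𝒢 : FinGraph.{u} => momentFunctional (V := 𝒢.V) M) T := by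
  have hinput := input_mem_messagePassing.{u}
  refine mem_treeAttainable_of_slotAlgebra hT (mul_mem (slot_mem_slotAlgebra a hinput)
    (slot_mem_slotAlgebra b (shift_mem_messagePassing hinput))) fun 𝒢 x _ => ?_
  rw [edgeWeight_cons, edgeWeight_nil, mul_one, 𝒢.S_comm]
  exact momentFunctional_X_mul_sum hM _ (x a)

theorem pair_mem_treeAttainable (hM : IsStandardized M) (hT : IsForest T) {a b c d : A}
    (hac : Linked T a c) (hbc : Linked T b c) :
    (fun 𝒢 => edgeWeight 𝒢.S [(a, b), (c, d)]) ∈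
      treeAttainable (fun 𝒢 : FinGraph.{u} => momentFunctional (V := 𝒢.V) M) T := by
  have hinput := input_mem_messagePassing.{u}
  have hX (l : A) := slot_mem_slotAlgebra l hinput
  have hU (l : A) := slot_mem_slotAlgebra l (shift_mem_messagePassing hinput)
  refine mem_treeAttainable_of_slotAlgebra hT (sub_mem
    (mul_mem (mul_mem (mul_mem (hX a) (hX c)) (hU b)) (hU d)) (mul_mem (hX a) (hU d)))
    fun 𝒢 x hx => ?_
  have hexp := momentFunctional_X_mul_X_mul_sum_mul_sum hM (𝒢.S (x b)) (𝒢.S (x d))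
    (hac.adj hx).ne
  have hedge := momentFunctional_X_mul_sum hM (𝒢.S (x d)) (x a)
  rw [FinGraph.S_eq_one (hbc.adj hx), mul_one, 𝒢.S_comm _ (x a), 𝒢.S_comm _ (x c)] at hexp
  simp only [edgeWeight_cons, edgeWeight_nil, mul_one]
  exact (map_sub _ _ _).trans ((congrArg₂ _ hexp hedge).trans (add_sub_cancel_right _ _))

theorem bookPoly_mem {R : Type*} [CommRing R] [Algebra ℝ R] {B : Subalgebra ℝ R}
    {x U Y du dw : R} (hx : x ∈ B) (hU : U ∈ B) (hY : Y ∈ B) (hdu : du ∈ B) (hdw : dw ∈ B) :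
    bookPoly M x U Y du dw ∈ B := by
  have hdw' := B.smul_mem (sub_mem hdw (one_mem B)) (1 / 2)
  exact add_mem (add_mem
    (B.smul_mem (mul_mem (mul_mem hx (pow_mem (sub_mem hU hx) 2)) (pow_mem hY 3)) _)
    (B.smul_mem (mul_mem (mul_mem hx (sub_mem hU hx)) (pow_mem hY 2)) _))
    (mul_mem (mul_mem hx hY) (sub_mem (one_mem B) (mul_mem (sub_mem hdu (one_mem B))
      (add_mem hdw' (B.algebraMap_mem _)))))

theorem book_mem_treeAttainable (hM : IsStandardized M) {a b c m s : A}
    (hT : IsForest ((s, c) :: (s, b) :: T)) (hsa : Linked T s a)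
    (hm : m ≠ b ∧ m ≠ c) :
    (fun 𝒢 => edgeWeight 𝒢.S [(a, m), (b, m), (c, m)]) ∈
      treeAttainable (fun 𝒢 : FinGraph.{u} => momentFunctional (V := 𝒢.V) M)
        ((s, c) :: (s, b) :: T) := by
  have hinput := input_mem_messagePassing.{u}
  have hone := one_mem messagePassing.{u}
  have hcb : c ≠ b := (hT.child_ne (s, b) List.mem_cons_self).2
  have hbs : b ≠ s := hT.of_cons.1 (s, b) List.mem_cons_self
  have hca : c ≠ a := hsa.elim (fun h => (hT.child_ne _ (.tail _ h)).2)
    fun h => (hT.child_ne _ (.tail _ h)).1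
  have hba : b ≠ a := hsa.elim (fun h => (hT.of_cons.child_ne _ h).2)
    fun h => (hT.of_cons.child_ne _ h).1
  rw [mem_treeAttainable_cons hT, mem_treeAttainable_cons hT.of_cons]
  refine mem_treeAttainable_of_slotAlgebra hT.of_cons.of_cons
    (bookPoly_mem (M := M) (slot_mem_slotAlgebra a hinput)
      (slot_mem_slotAlgebra s (shift_mem_messagePassing hinput))
      (slot_mem_slotAlgebra m (shift_mem_messagePassing hinput))
      (slot_mem_slotAlgebra s (shift_mem_messagePassing hone))
      (slot_mem_slotAlgebra m (shift_mem_messagePassing hone))) fun 𝒢 x hx => ?_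
  refine (momentFunctional_bookPoly hM (𝒢.S_mul_self (x s)) (𝒢.S_mul_self (x m))
    (FinGraph.S_eq_one (hsa.adj hx))).trans ?_
  simp only [sq, Finset.sum_mul_sum]
  simp only [edgeWeight_cons, edgeWeight_nil, mul_one, Function.update_self,
    Function.update_of_ne hca.symm, Function.update_of_ne hcb.symm,
    Function.update_of_ne hba.symm, Function.update_of_ne hbs.symm, Function.update_of_ne hm.1,
    Function.update_of_ne hm.2, 𝒢.S_comm _ (x m), Finset.mul_sum]
  exact Finset.sum_congr rfl fun y _ => Finset.sum_congr rfl fun z _ => by ring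

end MomentRules

section WalkQuotients

variable {A : Type*}

/-- The pairs of cyclically consecutive members of a list. -/
def cyclicSteps (l : List A) : List (A × A) := l.zip (l.rotate 1)

/-- The forest `T`, whose only root with an edge is the first label of `l`, and the edges `ex`
present the graph traced out by the closed walk with the labels `l`. -/
def Presents (l : List A) (T ex : List (A × A)) : Prop :=
  IsForest T ∧ (∀ a ∈ l, a ∈ T.map Prod.snd ↔ a ∉ l.head?) ∧
    (∀ e ∈ cyclicSteps l, Linked (T ++ ex) e.1 e.2) ∧
    ∀ e ∈ T ++ ex, Linked (cyclicSteps l) e.1 e.2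

instance [DecidableEq A] (l : List A) (T ex : List (A × A)) : Decidable (Presents l T ex) :=
  inferInstanceAs (Decidable (_ ∧ _))

theorem head?_ofFn {k : ℕ} [NeZero k] (w : Fin k → A) : (List.ofFn w).head? = some (w 0) := by
  cases k with
  | zero => exact absurd rfl (NeZero.ne 0)
  | succ n => rw [List.ofFn_succ, List.head?_cons]

theorem cyclicSteps_ofFn {k : ℕ} [NeZero k] (w : Fin k → A) :
    cyclicSteps (List.ofFn w) = List.ofFn fun i => (w i, w (i + 1)) := by
  refine List.ext_getElem (by simp [cyclicSteps]) fun i hi _ => ?_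
  simp only [cyclicSteps, List.getElem_zip, List.getElem_rotate, List.getElem_ofFn,
    List.length_ofFn, Prod.mk.injEq, true_and]
  exact congrArg w (Fin.ext (by simp [Fin.val_add]))

variable {k : ℕ} [NeZero k] {w : Fin k → A} {T ex : List (A × A)}

theorem Presents.forall_adj_iff (h : Presents (List.ofFn w) T ex) {V : Type*}
    {G : SimpleGraph V} {z : A → V} :
    (∀ e ∈ T ++ ex, G.Adj (z e.1) (z e.2)) ↔ ∀ i, G.Adj (z (w i)) (z (w (i + 1))) := by
  obtain ⟨-, -, hsteps, hedges⟩ := h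
  rw [cyclicSteps_ofFn, List.forall_mem_ofFn_iff] at hsteps
  refine ⟨fun hz i => (hsteps i).adj hz, fun hz e he => (hedges e he).adj ?_⟩
  rwa [cyclicSteps_ofFn, List.forall_mem_ofFn_iff]

theorem Presents.mem_range (h : Presents (List.ofFn w) T ex) {a : A}
    (ha : a ∈ T.map Prod.snd) : a ∈ Set.range w := by
  obtain ⟨e, he, rfl⟩ := List.mem_map.mp ha
  have hlink := h.2.2.2 e (List.mem_append_left _ he)
  rw [cyclicSteps_ofFn, Linked, List.mem_ofFn, List.mem_ofFn] at hlink
  obtain ⟨i, hi⟩ | ⟨i, hi⟩ := hlink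
  · exact ⟨i + 1, congrArg Prod.snd hi⟩
  · exact ⟨i, congrArg Prod.fst hi⟩

section ClosedWalks

variable {V : Type*} [Fintype V] [DecidableEq V] (G : SimpleGraph V) [DecidableRel G.Adj]

/-- The closed walks with `k` steps that start at `v`. -/
def closedWalks (k : ℕ) [NeZero k] (v : V) : Finset (Fin k → V) :=
  {x | x 0 = v ∧ ∀ i, G.Adj (x i) (x (i + 1))}

variable {G}

theorem mem_closedWalks {v : V} {x : Fin k → V} :
    x ∈ closedWalks G k v ↔ x 0 = v ∧ ∀ i, G.Adj (x i) (x (i + 1)) := by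
  simp [closedWalks]

variable [Fintype A] [DecidableEq A]

open scoped Classical in
theorem Presents.forestSum_edgeWeight (h : Presents (List.ofFn w) T ex) (v : V) :
    forestSum (G.adjMatrix ℝ) T v (edgeWeight (G.adjMatrix ℝ) ex) =
      #{x ∈ closedWalks G k v | Setoid.ker w ≤ Setoid.ker x} := by
  have hroot (i : Fin k) : w i ∉ T.map Prod.snd ↔ w i = w 0 := by
    have := h.2.1 (w i) (List.mem_ofFn.mpr ⟨i, rfl⟩)
    rw [head?_ofFn, Option.mem_some_iff] at this
    rw [this, not_not, eq_comm]
  simp only [forestSum_apply, smul_eq_mul, ← edgeWeight_append]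
  simp only [edgeWeight_adjMatrix, h.forall_adj_iff, Finset.sum_boole]
  congr 1
  refine Finset.card_nbij' (· ∘ w) (fun x => Function.extend w x fun _ => v) ?_ ?_ ?_ ?_
  · intro z hz
    simp only [Finset.coe_filter, Set.mem_ofPred_eq, mem_placements, mem_closedWalks] at hz ⊢
    exact ⟨⟨hz.1 _ ((hroot 0).mpr rfl), hz.2⟩, fun i j hij => congrArg z hij⟩
  · intro x hx
    simp only [Finset.coe_filter, Set.mem_ofPred_eq, mem_placements, mem_closedWalks] at hx ⊢
    have hfac : x.FactorsThrough w := fun i j hij => hx.2 hij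
    refine ⟨fun a ha => ?_, by simpa only [hfac.extend_apply] using hx.1.2⟩
    by_cases haw : ∃ i, w i = a
    · obtain ⟨i, rfl⟩ := haw
      rw [hfac.extend_apply, hfac ((hroot i).mp ha), hx.1.1]
    · rw [Function.extend_apply' _ _ _ haw]
  · intro z hz
    simp only [Finset.coe_filter, Set.mem_ofPred_eq, mem_placements] at hz
    funext a
    by_cases haw : ∃ i, w i = a
    · obtain ⟨i, rfl⟩ := haw
      exact Function.FactorsThrough.extend_apply (fun i j hij => congrArg z hij) _ i
    · exact (Function.extend_apply' _ _ _ haw).trans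
        (hz.1 a fun ha => haw (h.mem_range ha)).symm
  · intro x hx
    simp only [Finset.coe_filter, Set.mem_ofPred_eq] at hx
    have hfac : x.FactorsThrough w := fun i j hij => hx.2 hij
    funext i
    exact hfac.extend_apply (fun _ => v) i

end ClosedWalks

end WalkQuotients

section ClosedWalkCounts

theorem mem_of_forall_sum_le_mem {α M : Type*} [PartialOrder α] [Fintype α] [DecidableLE α]
    [AddCommGroup M] (N : AddSubgroup M) {g : α → M} (h : ∀ a, ∑ b with a ≤ b, g b ∈ N) (a : α) :
    g a ∈ N := by
  classical
  induction a using WellFoundedGT.induction with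
  | ind a ih =>
    have hsplit : Finset.univ.filter (a ≤ ·) = insert a (Finset.univ.filter (a < ·)) := by
      ext b
      simp [le_iff_eq_or_lt, eq_comm]
    have hsum := h a
    rw [hsplit, Finset.sum_insert (by simp)] at hsum
    exact (N.add_mem_cancel_right (N.sum_mem fun b hb => ih b (Finset.mem_filter.mp hb).2)).mp hsum

variable {k : ℕ} [NeZero k]

open scoped Classical in
theorem injective_closedWalks_mem_attainable_of_forall_le {L : SignalFunctional.{u}}
    (h : ∀ r : Setoid (Fin k), (fun (𝒢 : FinGraph.{u}) v =>
      (#{x ∈ closedWalks 𝒢.graph k v | r ≤ Setoid.ker x} : ℝ)) ∈ attainable L) :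
    (fun (𝒢 : FinGraph.{u}) v =>
      (#{x ∈ closedWalks 𝒢.graph k v | Function.Injective x} : ℝ)) ∈ attainable L := by
  have : Fintype (Setoid (Fin k)) :=
    Fintype.ofInjective (fun r => {p : Fin k × Fin k | r p.1 p.2}) fun r s hrs =>
      Setoid.ext fun i j => Set.ext_iff.mp hrs (i, j)
  simp only [Setoid.injective_iff_ker_bot]
  refine mem_of_forall_sum_le_mem (attainable L).toAddSubgroup
    (g := fun r (𝒢 : FinGraph.{u}) v => (#{x ∈ closedWalks 𝒢.graph k v | Setoid.ker x = r} : ℝ))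
    (fun r => ?_) ⊥
  change _ ∈ attainable L
  convert h r using 1
  funext 𝒢 v
  have hfiber : #{x ∈ closedWalks 𝒢.graph k v | r ≤ Setoid.ker x} =
      ∑ s with r ≤ s, #{x ∈ closedWalks 𝒢.graph k v | Setoid.ker x = s} := by
    rw [Finset.card_eq_sum_card_fiberwise (f := Setoid.ker) (t := {s | r ≤ s}) fun x hx => by
      simpa using (Finset.mem_filter.mp hx).2]
    refine Finset.sum_congr rfl fun s hs => ?_
    have hrs : r ≤ s := by simpa using hs
    rw [Finset.filter_filter]
    congr 2
    funext x
    exact propext (and_iff_right_of_imp fun hx => hrs.trans_eq hx.symm)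
  simp only [hfiber, Finset.sum_apply, Nat.cast_sum]

end ClosedWalkCounts

section Words

variable {A : Type*} [DecidableEq A]

/-- Words of the same length as the given list in which each letter is either the entry of the list
at its position or a repetition of a later letter. They encode the partitions of the set of
positions. -/
def labelWords : List A → List (List A)
  | [] => [[]]
  | a :: l => (labelWords l).flatMap fun w => (a :: w.dedup).map (· :: w)

theorem map_mem_labelWords [LinearOrder A] {l : List A} (hl : l.Pairwise (· < ·)) {w : A → A}
    (hw : ∀ a ∈ l, w a ∈ l ∧ a ≤ w a ∧ w (w a) = w a) : l.map w ∈ labelWords l := by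
  induction l with
  | nil => simp [labelWords]
  | cons a l ih =>
    rw [List.pairwise_cons] at hl
    rw [List.map_cons, labelWords, List.mem_flatMap]
    refine ⟨l.map w, ih hl.2 fun b hb => ?_, List.mem_map.mpr ⟨w a, ?_, rfl⟩⟩
    · obtain ⟨hmem, hle, hidem⟩ := hw b (.tail a hb)
      exact ⟨(List.mem_cons.mp hmem).resolve_left ((hl.1 b hb).trans_le hle).ne', hle, hidem⟩
    · obtain ⟨hmem, -, hidem⟩ := hw a List.mem_cons_self
      refine List.mem_cons.mpr ((List.mem_cons.mp hmem).imp_right fun h => ?_)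
      exact List.mem_dedup.mpr (List.mem_map.mpr ⟨w a, h, hidem⟩)

theorem exists_ofFn_mem_labelWords {k : ℕ} (r : Setoid (Fin k)) :
    ∃ w : Fin k → Fin k, List.ofFn w ∈ labelWords (List.finRange k) ∧ Setoid.ker w = r := by
  classical
  have hmax (i : Fin k) : ∃ m, r i m ∧ ∀ j, r i j → j ≤ m := by
    obtain ⟨m, hm, hle⟩ := Finset.exists_max_image {j | r i j} id ⟨i, by simp⟩
    exact ⟨m, by simpa using hm, by simpa using hle⟩
  choose w hrw hw using hmax
  have heq {i j : Fin k} (h : r i j) : w i = w j :=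
    le_antisymm (hw j _ (r.trans (r.symm h) (hrw i))) (hw i _ (r.trans h (hrw j)))
  refine ⟨w, ?_, Setoid.ext fun i j => ⟨fun h => ?_, heq⟩⟩
  · rw [List.ofFn_eq_map]
    exact map_mem_labelWords (List.pairwise_lt_finRange k) fun i _ =>
      ⟨List.mem_finRange _, hw i i (r.refl i), (heq (hrw i)).symm⟩
  · exact r.trans (hrw i) (Setoid.ker_def.mp h ▸ r.symm (hrw j))

end Words

section Certificates

variable {A : Type*} [DecidableEq A]

/-- One orientation of each edge in a list. -/
def simpleEdges : List (A × A) → List (A × A)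
  | [] => []
  | e :: E => if Linked E e.1 e.2 then simpleEdges E else e :: simpleEdges E

/-- Attaches at most `n` edges of `D` to the given vertices, each time the first edge that leads to
a new vertex. -/
def growForest (D : List (A × A)) : ℕ → List A → List (A × A)
  | 0, _ => []
  | n + 1, verts =>
    match D.find? fun e => e.1 ∈ verts ∧ e.2 ∉ verts with
    | none => []
    | some e => growForest D n (e.2 :: verts) ++ [e]

/-- A spanning tree with root `r` of the graph with edges `E` that avoids the edges `ex`. The ends
of `ex` are attached as early as possible and in that order, hence the pages of a book last. -/
def treeAvoiding (E : List (A × A)) (verts : List A) (r : A) (ex : List (A × A)) :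
    List (A × A) :=
  growForest ((ex.flatMap (fun e => [e.1, e.2]) ++ verts).flatMap fun c =>
    (E ++ E.map Prod.swap).filter fun e => e.2 = c ∧ ¬ Linked ex e.1 e.2) verts.length [r]

/-- The sets of `n` edges in `E` that share an end, directed towards it. -/
def stars (E : List (A × A)) (verts : List A) (n : ℕ) : List (List (A × A)) :=
  verts.flatMap fun m => ((E ++ E.map Prod.swap).filter fun e => e.2 = m).sublistsLen n

/-- The pairs of edges of which the first spans a triangle with the source of the second. -/
def trianglePairs (E : List (A × A)) : List (List (A × A)) :=
  E.flatMap fun e => ((E ++ E.map Prod.swap).filter fun f =>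
    Linked E e.1 f.1 ∧ Linked E e.2 f.1).map fun f => [e, f]

/-- The closed walk with labels `l` contains a loop, or its graph is presented by a spanning tree
and edges that satisfy `rule`, the latter taken from `candidates edges vertices n` where `n` is the
number of edges outside a spanning tree. -/
def Certified (candidates : List (A × A) → List A → ℕ → List (List (A × A)))
    (rule : List (A × A) → List (A × A) → Prop) (l : List A) : Prop :=
  (∃ e ∈ cyclicSteps l, e.1 = e.2) ∨
    let E := simpleEdges (cyclicSteps l)
    let verts := l.dedup
    ∃ r ∈ l.head?, ∃ ex ∈ candidates E verts (E.length + 1 - verts.length),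
      let T := treeAvoiding E verts r ex
      rule T ex ∧ Presents l T ex

instance (candidates : List (A × A) → List A → ℕ → List (List (A × A)))
    (rule : List (A × A) → List (A × A) → Prop) [∀ T ex, Decidable (rule T ex)] (l : List A) :
    Decidable (Certified candidates rule l) :=
  inferInstanceAs (Decidable (_ ∨ ∃ r ∈ _, ∃ ex ∈ _, _ ∧ _))

/-- The edges in `ex` have a common end. -/
def StarRule (_ ex : List (A × A)) : Prop := ∀ e ∈ ex, ∀ f ∈ ex, e.2 = f.2

instance (T ex : List (A × A)) : Decidable (StarRule T ex) :=
  inferInstanceAs (Decidable (∀ e ∈ ex, ∀ f ∈ ex, _))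

theorem certified_starRule :
    ∀ j : Fin 5, ∀ l ∈ labelWords (List.finRange (j + 3)), Certified stars StarRule l := by
  decide +kernel

/-- At most one edge in `ex`, or two of which one closes a triangle, or three which are the edges
from an apex to a base vertex and to the two pages of a book that are the last leaves of `T`. -/
def MomentRule : List (A × A) → List (A × A) → Prop
  | _, [] => True
  | _, [_] => True
  | T, [e, f] => Linked T e.1 f.1 ∧ Linked T e.2 f.1
  | (s, c) :: (s', b) :: T, [(a, m), e, f] =>
    s' = s ∧ e = (b, m) ∧ f = (c, m) ∧ Linked T s a ∧ m ≠ b ∧ m ≠ c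
  | _, _ => False

instance (T ex : List (A × A)) : Decidable (MomentRule T ex) := by
  unfold MomentRule
  split <;> infer_instance

/-- The shapes of the edges outside the spanning tree that `MomentRule` can allow. -/
def momentCandidates (E : List (A × A)) (verts : List A) (n : ℕ) : List (List (A × A)) :=
  if n = 2 then trianglePairs E else stars E verts n

theorem certified_momentRule : ∀ j : Fin 5, ∀ l ∈ labelWords (List.finRange (j + 3)),
    Certified momentCandidates MomentRule l := by
  decide +kernel

end Certificates

section Soundness

variable {A : Type*} [Fintype A] [DecidableEq A]

/-- A rule is sound for `L` if the products of the edges that it allows outside a tree can be summed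
over the placements of the tree by applying `L` to a message passing feature. -/
def IsSoundRule (L : SignalFunctional.{u}) (rule : List (A × A) → List (A × A) → Prop) : Prop :=
  ∀ T ex, IsForest T → rule T ex → (fun 𝒢 => edgeWeight 𝒢.S ex) ∈ treeAttainable L T

theorem isSoundRule_starRule [Nonempty A] :
    IsSoundRule (fun 𝒢 : FinGraph.{u} => basisFunctional 𝒢.V) (StarRule (A := A)) := by
  intro T ex hT hrule
  cases ex with
  | nil => exact star_mem_treeAttainable hT (m := Classical.arbitrary A) fun _ he => nomatch he
  | cons e ex => exact star_mem_treeAttainable hT fun f hf => hrule f hf e List.mem_cons_self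

theorem isSoundRule_momentRule {M : ℕ → ℝ} (hM : IsStandardized M) :
    IsSoundRule (fun 𝒢 : FinGraph.{u} => momentFunctional (V := 𝒢.V) M)
      (MomentRule (A := A)) := by
  intro T ex hT hrule
  unfold MomentRule at hrule
  split at hrule
  · exact nil_mem_treeAttainable hM hT
  · exact singleton_mem_treeAttainable hM hT _ _
  · exact pair_mem_treeAttainable hM hT hrule.1 hrule.2
  · obtain ⟨rfl, rfl, rfl, hsa, hm⟩ := hrule
    exact book_mem_treeAttainable hM hT hsa hm
  · exact hrule.elim

variable {k : ℕ} [NeZero k] {L : SignalFunctional.{u}}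
  {candidates : List (A × A) → List A → ℕ → List (List (A × A))}
  {rule : List (A × A) → List (A × A) → Prop}

open scoped Classical in
theorem Certified.closedWalks_mem_attainable {w : Fin k → A} (hrule : IsSoundRule L rule)
    (h : Certified candidates rule (List.ofFn w)) :
    (fun (𝒢 : FinGraph.{u}) v =>
      (#{x ∈ closedWalks 𝒢.graph k v | Setoid.ker w ≤ Setoid.ker x} : ℝ)) ∈ attainable L := by
  obtain ⟨e, he, heq⟩ | ⟨r, -, ex, -, hex, hpres⟩ := h
  · rw [cyclicSteps_ofFn, List.mem_ofFn] at he
    obtain ⟨i, rfl⟩ := he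
    convert zero_mem (attainable L) using 1
    funext 𝒢 v
    simp only [Pi.zero_apply, Nat.cast_eq_zero, Finset.card_eq_zero,
      Finset.filter_eq_empty_iff, mem_closedWalks]
    exact fun x hx hker => ((hx.2 i).ne (hker heq)).elim
  · simpa only [mem_treeAttainable, FinGraph.S, hpres.forestSum_edgeWeight] using
      hrule _ ex hpres.1 hex

open scoped Classical in
theorem IsSoundRule.injective_closedWalks_mem_attainable
    {candidates : List (Fin k × Fin k) → List (Fin k) → ℕ → List (List (Fin k × Fin k))}
    {rule : List (Fin k × Fin k) → List (Fin k × Fin k) → Prop} (hrule : IsSoundRule L rule)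
    (h : ∀ l ∈ labelWords (List.finRange k), Certified candidates rule l) :
    (fun (𝒢 : FinGraph.{u}) v =>
      (#{x ∈ closedWalks 𝒢.graph k v | Function.Injective x} : ℝ)) ∈ attainable L := by
  refine injective_closedWalks_mem_attainable_of_forall_le fun r => ?_
  obtain ⟨w, hw, rfl⟩ := exists_ofFn_mem_labelWords r
  exact (h _ hw).closedWalks_mem_attainable hrule

end Soundness

section CopiesOfCycles

variable {n : ℕ}

theorem cycleGraph_adj_add_one (i : Fin (n + 3)) :
    (SimpleGraph.cycleGraph (n + 3)).Adj i (i + 1) :=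
  SimpleGraph.cycleGraph_adj.mpr (.inr (add_sub_cancel_left i 1))

/-- The rotation of a cycle by `a`. -/
def cycleRotation (a : Fin (n + 3)) :
    SimpleGraph.cycleGraph (n + 3) ≃g SimpleGraph.cycleGraph (n + 3) where
  toEquiv := Equiv.addRight a
  map_rel_iff' := by simp [SimpleGraph.cycleGraph_adj]

/-- The reflection of a cycle that fixes `0`. -/
def cycleReflection (n : ℕ) :
    SimpleGraph.cycleGraph (n + 3) ≃g SimpleGraph.cycleGraph (n + 3) where
  toEquiv := Equiv.neg _
  map_rel_iff' := by simp [SimpleGraph.cycleGraph_adj, or_comm, neg_add_eq_sub]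

theorem one_add_one_ne_zero_of_fin : (1 + 1 : Fin (n + 3)) ≠ 0 := by
  simp [Fin.ext_iff, Fin.val_add, Nat.mod_eq_of_lt]

theorem cycleReflection_one_ne_one : cycleReflection n 1 ≠ 1 := fun h =>
  one_add_one_ne_zero_of_fin (add_eq_zero_iff_eq_neg.mpr h.symm)

variable {e : SimpleGraph.cycleGraph (n + 3) ≃g SimpleGraph.cycleGraph (n + 3)}

theorem cycleGraph_iso_apply_add_one_add_one {i : Fin (n + 3)} (hi : e i = i)
    (hi' : e (i + 1) = i + 1) : e (i + 1 + 1) = i + 1 + 1 := by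
  have hadj := e.map_adj_iff.mpr (cycleGraph_adj_add_one (i + 1))
  rw [hi', SimpleGraph.cycleGraph_adj] at hadj
  obtain hback | hforth := hadj
  · have hreturn : e (i + 1 + 1) = e i := by
      rw [hi, ← sub_sub_cancel (i + 1) (e (i + 1 + 1)), hback, add_sub_cancel_right]
    have htwo := e.injective hreturn
    rw [add_assoc, add_eq_left] at htwo
    exact absurd htwo one_add_one_ne_zero_of_fin
  · exact eq_add_of_sub_eq' hforth

theorem cycleGraph_iso_eq_refl (h₀ : e 0 = 0) (h₁ : e 1 = 1) (i : Fin (n + 3)) : e i = i := by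
  have hpair (i : Fin (n + 2)) : e i.castSucc = i.castSucc ∧ e i.succ = i.succ := by
    induction i using Fin.induction with
    | zero => exact ⟨h₀, h₁⟩
    | succ i ih =>
      refine ⟨ih.2, ?_⟩
      simpa only [Fin.succ_castSucc, Fin.coeSucc_eq_succ] using
        cycleGraph_iso_apply_add_one_add_one ih.1 (by simpa only [Fin.coeSucc_eq_succ] using ih.2)
  induction i using Fin.cases with
  | zero => exact h₀
  | succ i => exact (hpair i).2

theorem cycleGraph_iso_eq_refl_or_reflection (h₀ : e 0 = 0) :
    (∀ i, e i = i) ∨ ∀ i, e i = cycleReflection n i := by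
  have hadj := e.map_adj_iff.mpr (cycleGraph_adj_add_one 0)
  rw [zero_add, h₀, SimpleGraph.cycleGraph_adj, zero_sub, sub_zero] at hadj
  obtain h₁ | h₁ := hadj
  · refine .inr fun i => ?_
    have := cycleGraph_iso_eq_refl (e := e.trans (cycleReflection n))
      (by simp [cycleReflection, h₀]) (by simpa [cycleReflection] using h₁) i
    exact neg_eq_iff_eq_neg.mp this
  · exact .inl (cycleGraph_iso_eq_refl h₀ h₁)

variable {V W : Type*} {G : SimpleGraph V} {H : SimpleGraph W}

theorem toSubgraph_comp_iso (f : H.Copy G) (e : H ≃g H) :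
    (f.comp e.toCopy).toSubgraph = f.toSubgraph := by
  change SimpleGraph.Subgraph.map (f.toHom.comp e.toHom) ⊤ = _
  rw [SimpleGraph.Subgraph.map_comp, SimpleGraph.Subgraph.map_iso_top]

theorem exists_iso_of_toSubgraph_eq {f g : H.Copy G} (h : f.toSubgraph = g.toSubgraph) :
    ∃ e : H ≃g H, f = g.comp e.toCopy := by
  obtain ⟨φ, hφ⟩ : ∃ φ : H ≃g g.toSubgraph.coe, ∀ a, (φ a : V) = f a :=
    h ▸ ⟨f.isoToSubgraph, fun _ => rfl⟩
  refine ⟨φ.trans g.isoToSubgraph.symm, SimpleGraph.Copy.ext fun a => ?_⟩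
  rw [← hφ]
  exact congrArg Subtype.val (g.isoToSubgraph.apply_symm_apply (φ a)).symm

theorem exists_copy_cycleGraph_of_mem_verts {B : G.Subgraph} {v : V} (hv : v ∈ B.verts)
    (hB : Nonempty (B.coe ≃g SimpleGraph.cycleGraph (n + 3))) :
    ∃ f : (SimpleGraph.cycleGraph (n + 3)).Copy G, f 0 = v ∧ f.toSubgraph = B := by
  obtain ⟨f, rfl⟩ : B ∈ Set.range SimpleGraph.Copy.toSubgraph :=
    SimpleGraph.Copy.range_toSubgraph.ge (hB.map SimpleGraph.Iso.symm)
  obtain ⟨a, -, rfl⟩ := hv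
  refine ⟨f.comp (cycleRotation a).toCopy, ?_, toSubgraph_comp_iso f _⟩
  exact congrArg f (zero_add a)

theorem toSubgraph_eq_iff_of_apply_zero_eq {f g : (SimpleGraph.cycleGraph (n + 3)).Copy G}
    (h₀ : f 0 = g 0) :
    f.toSubgraph = g.toSubgraph ↔ f = g ∨ f = g.comp (cycleReflection n).toCopy := by
  refine ⟨fun h => ?_, ?_⟩
  · obtain ⟨e, rfl⟩ := exists_iso_of_toSubgraph_eq h
    exact (cycleGraph_iso_eq_refl_or_reflection (g.injective h₀)).imp
      (fun he => SimpleGraph.Copy.ext fun i => congrArg g (he i))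
      fun he => SimpleGraph.Copy.ext fun i => congrArg g (he i)
  · rintro (rfl | rfl)
    exacts [rfl, toSubgraph_comp_iso g _]

theorem card_copies_eq_two_mul_cycleCount [Finite V] [DecidableEq V]
    [Fintype ((SimpleGraph.cycleGraph (n + 3)).Copy G)]
    (v : V) :
    #{f : (SimpleGraph.cycleGraph (n + 3)).Copy G | f 0 = v} = 2 * cycleCount G (n + 3) v := by
  classical
  have : Fintype G.Subgraph := Fintype.ofFinite _
  rw [cycleCount, Set.ncard_eq_toFinset_card', Set.toFinset_ofPred,
    Finset.card_eq_sum_card_fiberwise (f := SimpleGraph.Copy.toSubgraph)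
      (t := {B | v ∈ B.verts ∧ Nonempty (B.coe ≃g SimpleGraph.cycleGraph (n + 3))}),
    Finset.sum_const_nat (m := 2), mul_comm]
  · intro B hB
    obtain ⟨hv, hiso⟩ := (Finset.mem_filter.mp hB).2
    obtain ⟨g, rfl, rfl⟩ := exists_copy_cycleGraph_of_mem_verts hv hiso
    have hne : g ≠ g.comp (cycleReflection n).toCopy := fun h =>
      cycleReflection_one_ne_one (g.injective (DFunLike.congr_fun h 1)).symm
    refine Eq.trans ?_ (Finset.card_pair hne)
    congr 1
    ext f
    simp only [Finset.mem_filter, Finset.mem_univ, true_and, Finset.mem_insert,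
      Finset.mem_singleton]
    refine ⟨fun hf => (toSubgraph_eq_iff_of_apply_zero_eq hf.1).mp hf.2, fun hf => ?_⟩
    have h₀ : f 0 = g 0 := by
      obtain rfl | rfl := hf
      exacts [rfl, congrArg g neg_zero]
    exact ⟨h₀, (toSubgraph_eq_iff_of_apply_zero_eq h₀).mpr hf⟩
  · intro f hf
    simp only [Finset.coe_filter, Finset.mem_univ, true_and, Set.mem_ofPred_eq] at hf ⊢
    exact ⟨⟨0, trivial, hf⟩, ⟨f.isoToSubgraph.symm⟩⟩

open scoped Classical in
theorem card_injective_closedWalks [Fintype V] [DecidableEq V] [DecidableRel G.Adj] (v : V) :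
    #{x ∈ closedWalks G (n + 3) v | Function.Injective x} = 2 * cycleCount G (n + 3) v := by
  rw [← card_copies_eq_two_mul_cycleCount]
  symm
  refine Finset.card_nbij (fun f => f) ?_ DFunLike.coe_injective.injOn ?_
  · intro f hf
    simp only [Finset.coe_filter, Finset.mem_univ, true_and, Set.mem_ofPred_eq,
      mem_closedWalks] at hf ⊢
    exact ⟨⟨hf, fun i => f.toHom.map_adj (cycleGraph_adj_add_one i)⟩, f.injective⟩
  · intro x hx
    simp only [Finset.coe_filter, Set.mem_ofPred_eq, mem_closedWalks] at hx
    obtain ⟨⟨hx₀, hadj⟩, hinj⟩ := hx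
    have hhom {i j : Fin (n + 3)} (hij : (SimpleGraph.cycleGraph (n + 3)).Adj i j) :
        G.Adj (x i) (x j) := by
      rw [SimpleGraph.cycleGraph_adj] at hij
      obtain h | h := hij
      · exact eq_add_of_sub_eq' h ▸ (hadj j).symm
      · exact eq_add_of_sub_eq' h ▸ hadj i
    exact ⟨⟨⟨x, hhom⟩, hinj⟩, by simpa using hx₀, rfl⟩

end CopiesOfCycles

section CycleCounts

theorem IsSoundRule.cycleCount_mem_attainable {n : ℕ} {L : SignalFunctional.{u}}
    {candidates : List (Fin (n + 3) × Fin (n + 3)) → List (Fin (n + 3)) → ℕ →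
      List (List (Fin (n + 3) × Fin (n + 3)))}
    {rule : List (Fin (n + 3) × Fin (n + 3)) → List (Fin (n + 3) × Fin (n + 3)) → Prop}
    (hrule : IsSoundRule L rule)
    (h : ∀ l ∈ labelWords (List.finRange (n + 3)), Certified candidates rule l) :
    (fun (𝒢 : FinGraph.{u}) v => (cycleCount 𝒢.graph (n + 3) v : ℝ)) ∈ attainable L := by
  refine (Submodule.smul_mem_iff _ (two_ne_zero (α := ℝ))).mp ?_
  convert hrule.injective_closedWalks_mem_attainable h using 1
  funext 𝒢 v
  simp [card_injective_closedWalks]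

theorem exists_gnn_of_forall_mem_attainable {p n : ℕ} (hp : 2 ≤ p) {L : SignalFunctional.{u}}
    {f : Fin n → ∀ 𝒢 : FinGraph.{u}, 𝒢.V → ℝ} (hf : ∀ j, f j ∈ attainable L) :
    ∃ (Φ : GNN p 1 n) (F : Fin n → NodePoly.{u}),
      (∀ (𝒢 : FinGraph.{u}) (x : 𝒢.V → ℝ) (v : 𝒢.V) (j : Fin n),
        Φ.run 𝒢.graph x v j = aeval x (F j 𝒢 v)) ∧
      ∀ (𝒢 : FinGraph.{u}) (v : 𝒢.V) (j : Fin n), L 𝒢 (F j 𝒢 v) = f j 𝒢 v := by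
  choose F hF hL using fun j => mem_attainable.mp (hf j)
  obtain ⟨Φ, hΦ⟩ := exists_gnn_run_eq_aeval hp F hF
  exact ⟨Φ, F, hΦ, fun 𝒢 v j => hL j 𝒢 v⟩

theorem integrable_and_integral_aeval {μ : Measure ℝ} [SigmaFinite μ]
    (hμ : ∀ n : ℕ, Integrable (fun x : ℝ => x ^ n) μ) {V : Type*} [Fintype V] {Ω : Type*}
    [MeasurableSpace Ω] {P : Measure Ω} {q : V → Ω → ℝ} (hq : ∀ i, HasLaw (q i) μ P)
    (hind : iIndepFun q P) (f : MvPolynomial V ℝ) :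
    Integrable (fun ω => aeval (fun i => q i ω) f) P ∧
      ∫ ω, aeval (fun i => q i ω) f ∂P = momentFunctional (fun n => ∫ x, x ^ n ∂μ) f := by
  have hlaw : HasLaw (fun ω i => q i ω) (Measure.pi fun _ => μ) P := hind.hasLaw_pi hq
  induction f using MvPolynomial.induction_on' with
  | monomial s c =>
    have hpi : Integrable (fun x : V → ℝ => ∏ i, x i ^ s i) (Measure.pi fun _ => μ) :=
      Integrable.fintype_prod fun i => hμ (s i)
    have hmonomial (ω : Ω) : aeval (fun i => q i ω) (monomial s c) = c * ∏ i, q i ω ^ s i := by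
      rw [aeval_monomial, Finsupp.prod_fintype _ _ fun _ => pow_zero _, Algebra.algebraMap_self,
        RingHom.id_apply]
    have hprod : Integrable (fun ω => ∏ i, q i ω ^ s i) P :=
      (hlaw.map_eq ▸ hpi).comp_aemeasurable hlaw.aemeasurable
    simp only [hmonomial]
    refine ⟨hprod.const_mul c, ?_⟩
    rw [integral_const_mul, momentFunctional_monomial, ← integral_fintype_prod_eq_prod]
    exact congrArg (c * ·) (hlaw.integral_comp hpi.aestronglyMeasurable)
  | add f g hf hg =>
    simp only [map_add]
    exact ⟨hf.1.add hg.1, by rw [integral_add hf.1 hg.1, hf.2, hg.2]⟩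

end CycleCounts

end

theorem mainTheorem4_general.{u} (p : ℕ) (hp : 2 ≤ p) :
    (∀ μ : Measure ℝ, IsProbabilityMeasure μ →
      (∀ n : ℕ, Integrable (fun x : ℝ => x ^ n) μ) →
      ∫ x, x ∂μ = 0 → ∫ x, x ^ 2 ∂μ = 1 →
      ∃ Φ : GNN p 1 5,
        ∀ (V : Type u) [Fintype V] [DecidableEq V] (G : SimpleGraph V) [DecidableRel G.Adj]
          (Ω : Type*) [MeasurableSpace Ω] (P : Measure Ω) (q : V → Ω → ℝ),
          (∀ i, HasLaw (q i) μ P) → iIndepFun q P →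
          ∀ (v : V) (j : Fin 5),
            Integrable (fun ω => Φ.run G (fun i => q i ω) v j) P ∧
            ∫ ω, Φ.run G (fun i => q i ω) v j ∂P = (cycleCount G ((j : ℕ) + 3) v : ℝ)) ∧
    (∃ Ψ : GNN p 1 5,
      ∀ (V : Type u) [Fintype V] [DecidableEq V] (G : SimpleGraph V) [DecidableRel G.Adj]
        (v : V) (j : Fin 5),
        ∑ m : V, Ψ.run G (Pi.single m 1) v j = (cycleCount G ((j : ℕ) + 3) v : ℝ)) := by
  constructor
  · intro μ _ hμ hmean hvar
    have hM : IsStandardized fun n => ∫ x, x ^ n ∂μ := ⟨by simp, by simpa using hmean, hvar⟩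
    obtain ⟨Φ, F, hΦ, hF⟩ := exists_gnn_of_forall_mem_attainable.{u} hp fun j : Fin 5 =>
      (isSoundRule_momentRule hM).cycleCount_mem_attainable (certified_momentRule j)
    refine ⟨Φ, fun V _ _ G _ Ω _ P q hq hind v j => ?_⟩
    obtain ⟨hintegrable, hexp⟩ := integrable_and_integral_aeval hμ hq hind (F j ⟨V, G⟩ v)
    simp only [hΦ ⟨V, G⟩]
    exact ⟨hintegrable, hexp.trans (hF ⟨V, G⟩ v j)⟩
  · obtain ⟨Ψ, F, hΨ, hF⟩ := exists_gnn_of_forall_mem_attainable.{u} hp fun j : Fin 5 =>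
      isSoundRule_starRule.cycleCount_mem_attainable (certified_starRule j)
    refine ⟨Ψ, fun V _ _ G _ v j => ?_⟩
    simpa only [hΨ ⟨V, G⟩, basisFunctional, LinearMap.sum_apply, AlgHom.toLinearMap_apply] using
      hF ⟨V, G⟩ v j

theorem mainTheorem4 (p : ℕ) (hp : 2 ≤ p) :
    (∀ μ : Measure ℝ, IsProbabilityMeasure μ →
      (∀ n : ℕ, Integrable (fun x : ℝ => x ^ n) μ) →
      ∫ x, x ∂μ = 0 → ∫ x, x ^ 2 ∂μ = 1 →
      ∃ Φ : GNN p 1 5,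
        ∀ (N : ℕ) (G : SimpleGraph (Fin N)) [DecidableRel G.Adj]
          (Ω : Type*) [MeasurableSpace Ω] (P : Measure Ω) (q : Fin N → Ω → ℝ),
          (∀ i, HasLaw (q i) μ P) → iIndepFun q P →
          ∀ (v : Fin N) (j : Fin 5),
            Integrable (fun ω => Φ.run G (fun i => q i ω) v j) P ∧
            ∫ ω, Φ.run G (fun i => q i ω) v j ∂P = (cycleCount G ((j : ℕ) + 3) v : ℝ)) ∧
    (∃ Ψ : GNN p 1 5,
      ∀ (N : ℕ) (G : SimpleGraph (Fin N)) [DecidableRel G.Adj] (v : Fin N) (j : Fin 5),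
        ∑ m : Fin N, Ψ.run G (Pi.single m 1) v j = (cycleCount G ((j : ℕ) + 3) v : ℝ)) := by
  obtain ⟨hmoments, hbasis⟩ := mainTheorem4_general p hp
  exact ⟨fun μ hμ hpow hmean hvar => (hmoments μ hμ hpow hmean hvar).imp fun _ hΦ N => hΦ (Fin N),
    hbasis.imp fun _ hΨ N => hΨ (Fin N)⟩
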